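/- Consider a polytropic ideal gas with density $\rho>0$, velocity $u$, pressure $p>0$, ratio of specific heats $1<\gamma\le 3$, total energy $E=\frac{p}{\gamma-1}+\frac12\rho u^2$, sound speed $a=\sqrt{\gamma p/\rho}$ and Mach number $M=|u|/a$. Write $\mathbf U=(\rho,\rho u,E)$ and $\mathbf F=(\rho u,\rho u^2+p,(E+p)u)$, and let $Q>0$. Consider $$\partial_t \mathbf U+\partial_x \mathbf F=(0,0,Q\,\delta(x)),\qquad \mathbf U(x,0)\equiv \mathbf U_1,$$ where $\mathbf U_1$ is a constant state with $u_1>0$. An *exact solution* (in the frame of two coupled classical Riemann problems) is a function $\mathbf U(x,t)$ such that * in each of the half planes $\{x<0,\ t>0\}$ and $\{x>0,\ t>0\}$ it is a self-similar, piecewise smooth entropy solution of the homogeneous Euler equations: off finitely many rays $x=st$ it is $C^1$ and solves the equations, and on each of these rays it has one-sided limits (with positive density and pressure) and either is continuous or has a jump that is a Lax shock or a contact discontinuity; and $\mathbf U(x,t)\to \mathbf U_1$ as $t\to0^+$ for every $x\neq0$; * it has constant limits $\mathbf U_4=\mathbf U(0-,t)$ and $\mathbf U_5=\mathbf U(0+,t)$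 with positive density and pressure, $u_4\ne0$, $u_5\neq 0$, that satisfy the heating relations $H(\mathbf U_4,\mathbf U_5)$: $$\rho_4u_4=\rho_5u_5,\quad \rho_4u_4^2+p_4=\rho_5u_5^2+p_5,\quad (E_4+p_4)u_4+Q=(E_5+p_5)u_5,$$ and lie on the physical branch: if the Mach number upstream of $x=0$ is $<1$ (resp. $>1$), the one downstream is $\le1$ (resp. $\ge1$). Denote by $S(\mathbf U_a,\mathbf U_b)$, $R(\mathbf U_a,\mathbf U_b)$, $C(\mathbf U_a,\mathbf U_b)$ a shock, a rarefaction wave, a contact discontinuity with left state $\mathbf U_a$ and right state $\mathbf U_b$, and write $\oplus$ for the succession of waves from left to right, separated by regions in which $\mathbf U$ is constant. **Theorem.** Every exact solution has exactly one of the following three structures, where $\mathbf U_8=\mathbf U_1$ and $\mathbf U_6,\mathbf U_7$ are suitable constant states. * Type 1: $M_4<M_5<1$ and the solution is $S(\mathbf U_1,\mathbf U_4)\oplus H(\mathbf U_4,\mathbf U_5)\oplus C(\mathbf U_5,\mathbf U_7)\oplus S(\mathbf U_7,\mathbf U_8)$. * Type 2: $M_4<M_5=1$ and the solution is $S(\mathbf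 U_1,\mathbf U_4)\oplus H(\mathbf U_4,\mathbf U_5)\oplus R(\mathbf U_5,\mathbf U_6)\oplus C(\mathbf U_6,\mathbf U_7)\oplus S(\mathbf U_7,\mathbf U_8)$, where the rarefaction wave starts at $x=0$ and may be degenerate ($\mathbf U_5=\mathbf U_6$). * Type 3: $M_4>M_5\ge1$, $\mathbf U_4=\mathbf U_1$, $\mathbf U=\mathbf U_1$ for all $x<0$, and the solution is $H(\mathbf U_1,\mathbf U_5)\oplus R(\mathbf U_5,\mathbf U_6)\oplus C(\mathbf U_6,\mathbf U_7)\oplus S(\mathbf U_7,\mathbf U_8)$. Here the shock $S(\mathbf U_1,\mathbf U_4)$ belongs to the characteristic field $u-a$ and has negative speed, $R$ belongs to the field $u-a$, and $C$ and the shock $S(\mathbf U_7,\mathbf U_8)$, which belongs to the field $u+a$, move with positive speed. -/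

import Mathlib

open Set Filter Topology

noncomputable section

/-- A gas state in primitive variables `(ρ, u, p)`: density, velocity, pressure. -/
abbrev State : Type := ℝ × ℝ × ℝ

namespace State

/-- Density. -/
def rho (V : State) : ℝ := V.1

/-- Velocity. -/
def vel (V : State) : ℝ := V.2.1

/-- Pressure. -/
def pres (V : State) : ℝ := V.2.2

/-- Positive density and pressure. -/
def IsPhysical (V : State) : Prop := 0 < V.rho ∧ 0 < V.pres

/-- Total energy `E = ρ e + ρ u² / 2` of the polytropic ideal gas `p = (γ - 1) ρ e`. -/
def energy (γ : ℝ) (V : State) : ℝ := V.pres / (γ - 1) + V.rho * V.vel ^ 2 / 2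

/-- The vector of conserved variables `(ρ, ρ u, E)`. -/
def cons (γ : ℝ) (V : State) : ℝ × ℝ × ℝ := (V.rho, V.rho * V.vel, V.energy γ)

/-- The flux `(ρ u, ρ u² + p, (E + p) u)`. -/
def flux (γ : ℝ) (V : State) : ℝ × ℝ × ℝ :=
  (V.rho * V.vel, V.rho * V.vel ^ 2 + V.pres, (V.energy γ + V.pres) * V.vel)

/-- Speed of sound `a = √(γ p / ρ)`. -/
def sound (γ : ℝ) (V : State) : ℝ := Real.sqrt (γ * V.pres / V.rho)

/-- Mach number `|u| / a`. -/
def mach (γ : ℝ) (V : State) : ℝ := |V.vel| / V.sound γ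

/-- The first characteristic speed `u - a`. -/
def char1 (γ : ℝ) (V : State) : ℝ := V.vel - V.sound γ

/-- The third characteristic speed `u + a` (the second one is `u`). -/
def char3 (γ : ℝ) (V : State) : ℝ := V.vel + V.sound γ

end State

/-! ### Elementary waves of the homogeneous Euler equations -/

/-- The Rankine-Hugoniot relations for a jump with left state `Vl`, right state `Vr`, speed `s`. -/
def RankineHugoniot (γ : ℝ) (Vl Vr : State) (s : ℝ) : Prop :=
  Vr.flux γ - Vl.flux γ = s • (Vr.cons γ - Vl.cons γ)

/-- A shock of the first family (Rankine-Hugoniot relations and Lax entropy inequalities). -/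
def IsShock1 (γ : ℝ) (Vl Vr : State) (s : ℝ) : Prop :=
  RankineHugoniot γ Vl Vr s ∧ s < Vl.char1 γ ∧ Vr.char1 γ < s ∧ s < Vr.vel

/-- A shock of the third family (Rankine-Hugoniot relations and Lax entropy inequalities). -/
def IsShock3 (γ : ℝ) (Vl Vr : State) (s : ℝ) : Prop :=
  RankineHugoniot γ Vl Vr s ∧ Vl.vel < s ∧ s < Vl.char3 γ ∧ Vr.char3 γ < s

/-- A contact discontinuity (a genuine one: the two states differ). -/
def IsContact (γ : ℝ) (Vl Vr : State) (s : ℝ) : Prop :=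
  RankineHugoniot γ Vl Vr s ∧ Vl.vel = s ∧ Vr.vel = s ∧ Vl ≠ Vr

/-- `Vl` and `V` have the same Riemann invariants `u + 2a/(γ-1)` and `p/ρ^γ` of the first family. -/
def SameInvariants1 (γ : ℝ) (Vl V : State) : Prop :=
  V.vel + 2 * V.sound γ / (γ - 1) = Vl.vel + 2 * Vl.sound γ / (γ - 1) ∧
  V.pres / V.rho ^ γ = Vl.pres / Vl.rho ^ γ

/-- A rarefaction wave of the first family joins `Vl` (on the left) to `Vr` (on the right).
The degenerate wave `Vl = Vr` of strength zero is included. -/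
def IsRarefaction1 (γ : ℝ) (Vl Vr : State) : Prop :=
  SameInvariants1 γ Vl Vr ∧ Vl.char1 γ ≤ Vr.char1 γ

/-! ### Solutions of the homogeneous Euler equations on a half plane -/

/-- `U` (with `U x t` the state at position `x` and time `t`) is a self-similar, piecewise smooth
entropy solution of the homogeneous Euler equations on `{(x, t) | x ∈ Ω, t > 0}`, where `Ω` is a
half line ending at `0`: away from finitely many rays `x = s t` it is `C¹` and satisfies the
equations classically; on each of these rays it has one-sided limits and is either continuous
or has a jump that is a Lax shock or a contact discontinuity. -/
structure SolvesEulerOn (γ : ℝ) (Ω : Set ℝ) (U : ℝ → ℝ → State) : Prop where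
  physical : ∀ x ∈ Ω, ∀ t > 0, (U x t).IsPhysical
  selfSimilar : ∀ x ∈ Ω, ∀ t > 0, ∀ c > 0, U (c * x) (c * t) = U x t
  piecewise : ∃ D : Finset ℝ,
    ContDiffOn ℝ 1 (fun z : ℝ × ℝ => U z.1 z.2) {z | z.1 ∈ Ω ∧ 0 < z.2 ∧ z.1 / z.2 ∉ D} ∧
    (∀ x ∈ Ω, ∀ t > 0, x / t ∉ D →
      deriv (fun τ => (U x τ).cons γ) t + deriv (fun y => (U y t).flux γ) x = 0) ∧
    ∀ s ∈ D, s ∈ Ω → ∃ Vl Vr : State, Vl.IsPhysical ∧ Vr.IsPhysical ∧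
      (∀ t > 0, Tendsto (fun x => U x t) (𝓝[<] (s * t)) (𝓝 Vl)) ∧
      (∀ t > 0, Tendsto (fun x => U x t) (𝓝[>] (s * t)) (𝓝 Vr)) ∧
      ((Vl = Vr ∧ ∀ t > 0, U (s * t) t = Vl) ∨
        IsShock1 γ Vl Vr s ∨ IsContact γ Vl Vr s ∨ IsShock3 γ Vl Vr s)

/-! ### The heating discontinuity and the exact solutions -/

/-- The heating discontinuity at `x = 0` with `Vl = U(0-,t)` and `Vr = U(0+,t)`: mass and momentum
fluxes are continuous, the energy flux jumps by `Q`, the velocities do not vanish, and the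
physical branch is taken, that is, heating turns neither an upstream subsonic flow into a
downstream supersonic one nor conversely. (Upstream is the left if `u > 0`, the right if `u < 0`.)
-/
structure IsHeating (γ Q : ℝ) (Vl Vr : State) : Prop where
  balance : Vl.flux γ + (0, 0, Q) = Vr.flux γ
  vel_left : Vl.vel ≠ 0
  vel_right : Vr.vel ≠ 0
  branch_pos : 0 < Vl.vel →
    (Vl.mach γ < 1 → Vr.mach γ ≤ 1) ∧ (1 < Vl.mach γ → 1 ≤ Vr.mach γ)
  branch_neg : Vl.vel < 0 →
    (Vr.mach γ < 1 → Vl.mach γ ≤ 1) ∧ (1 < Vr.mach γ → 1 ≤ Vl.mach γ)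

/-- `U` is an exact solution, in the frame of two coupled classical Riemann problems, of the Euler
equations with heat source `Q δ(x)` in the energy equation and constant initial state `U₁`;
`U₄` and `U₅` are its constant limit states on the left and on the right of `x = 0`. -/
structure IsExactSolution (γ Q : ℝ) (U₁ : State) (U : ℝ → ℝ → State) (U₄ U₅ : State) : Prop where
  left : SolvesEulerOn γ (Iio 0) U
  right : SolvesEulerOn γ (Ioi 0) U
  initial : ∀ x ≠ 0, Tendsto (fun t => U x t) (𝓝[>] 0) (𝓝 U₁)
  physical_left : U₄.IsPhysical
  physical_right : U₅.IsPhysical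
  limit_left : ∀ t > 0, Tendsto (fun x => U x t) (𝓝[<] 0) (𝓝 U₄)
  limit_right : ∀ t > 0, Tendsto (fun x => U x t) (𝓝[>] 0) (𝓝 U₅)
  heating : IsHeating γ Q U₄ U₅

/-! ### The three wave structures -/

/-- `U` has the constant value `V` in the sector `a t < x < b t`. -/
def ConstOn (U : ℝ → ℝ → State) (a b : ℝ) (V : State) : Prop :=
  ∀ t > 0, ∀ x, a * t < x → x < b * t → U x t = V

/-- In the sector `(u - a)(Vl) ≤ x / t ≤ (u - a)(Vr)`, off `x = 0`, `U` is the centered rarefaction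
fan of the first family issuing from `Vl`. -/
def FanOn (γ : ℝ) (U : ℝ → ℝ → State) (Vl Vr : State) : Prop :=
  ∀ t > 0, ∀ x ≠ 0, Vl.char1 γ * t ≤ x → x ≤ Vr.char1 γ * t →
    (U x t).IsPhysical ∧ SameInvariants1 γ Vl (U x t) ∧ (U x t).char1 γ = x / t

/-- `S(U₁,U₄) ⊕ H(U₄,U₅) ⊕ C(U₅,U₇) ⊕ S(U₇,U₈)` with `U₈ = U₁`. -/
def IsType1 (γ Q : ℝ) (U₁ : State) (U : ℝ → ℝ → State) (U₄ U₅ : State) : Prop :=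
  ∃ (U₇ : State) (sL sC sR : ℝ), U₇.IsPhysical ∧
    sL < 0 ∧ 0 < sC ∧ sC < sR ∧
    IsShock1 γ U₁ U₄ sL ∧ IsHeating γ Q U₄ U₅ ∧ IsContact γ U₅ U₇ sC ∧ IsShock3 γ U₇ U₁ sR ∧
    (∀ t > 0, ∀ x < sL * t, U x t = U₁) ∧
    ConstOn U sL 0 U₄ ∧ ConstOn U 0 sC U₅ ∧ ConstOn U sC sR U₇ ∧
    (∀ t > 0, ∀ x > sR * t, U x t = U₁)

/-- `S(U₁,U₄) ⊕ H(U₄,U₅) ⊕ R(U₅,U₆) ⊕ C(U₆,U₇) ⊕ S(U₇,U₈)` with `U₈ = U₁`; the rarefaction wave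
starts at `x = 0`, so that there is no sector with the state `U₅`. -/
def IsType2 (γ Q : ℝ) (U₁ : State) (U : ℝ → ℝ → State) (U₄ U₅ : State) : Prop :=
  ∃ (U₆ U₇ : State) (sL sC sR : ℝ), U₆.IsPhysical ∧ U₇.IsPhysical ∧
    sL < 0 ∧ U₅.char1 γ = 0 ∧ U₆.char1 γ < sC ∧ 0 < sC ∧ sC < sR ∧
    IsShock1 γ U₁ U₄ sL ∧ IsHeating γ Q U₄ U₅ ∧ IsRarefaction1 γ U₅ U₆ ∧
    IsContact γ U₆ U₇ sC ∧ IsShock3 γ U₇ U₁ sR ∧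
    (∀ t > 0, ∀ x < sL * t, U x t = U₁) ∧
    ConstOn U sL 0 U₄ ∧ FanOn γ U U₅ U₆ ∧ ConstOn U (U₆.char1 γ) sC U₆ ∧ ConstOn U sC sR U₇ ∧
    (∀ t > 0, ∀ x > sR * t, U x t = U₁)

/-- `H(U₁,U₅) ⊕ R(U₅,U₆) ⊕ C(U₆,U₇) ⊕ S(U₇,U₈)` with `U₄ = U₁` and `U₈ = U₁`; here the
rarefaction wave is never degenerate. -/
def IsType3 (γ Q : ℝ) (U₁ : State) (U : ℝ → ℝ → State) (U₄ U₅ : State) : Prop :=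
  U₄ = U₁ ∧
  ∃ (U₆ U₇ : State) (sC sR : ℝ), U₆.IsPhysical ∧ U₇.IsPhysical ∧
    0 ≤ U₅.char1 γ ∧ U₅.char1 γ < U₆.char1 γ ∧ U₆.char1 γ < sC ∧ sC < sR ∧
    IsHeating γ Q U₁ U₅ ∧ IsRarefaction1 γ U₅ U₆ ∧
    IsContact γ U₆ U₇ sC ∧ IsShock3 γ U₇ U₁ sR ∧
    (∀ t > 0, ∀ x < 0, U x t = U₁) ∧
    ConstOn U 0 (U₅.char1 γ) U₅ ∧ FanOn γ U U₅ U₆ ∧ ConstOn U (U₆.char1 γ) sC U₆ ∧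
    ConstOn U sC sR U₇ ∧
    (∀ t > 0, ∀ x > sR * t, U x t = U₁)

end

/-! A self-similar solution is a function of `ξ = x / t`. On an interval without breakpoints the
profile solves an ODE, and by `SimilarityODE.const_or_fan` it is constant or a centered fan of the
first or third family. Induction over the finitely many breakpoints (`IsProfile.tail`) and the Lax
inequalities (`Tail.wave3`, `Tail.wave23`, `Tail.wave123`) leave at most one wave per family, in the
usual order, in `x > 0`. The half plane `x < 0` is treated through its mirror image, which exchanges
the first and third families.

The source drives the Mach number towards 1 (`IsHeating.subsonic_or_supersonic`). In the flow
direction, subsonic heating lowers the pressure and accelerates the gas, supersonic heating does the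
opposite. A contact followed by a 3-wave changes pressure and velocity in the same direction
(`Wave23.sign`). These monotonicities fix the flow direction at `x = 0`, force a 1-shock on the left
in the subsonic case, and force a proper 1-rarefaction on the right in the supersonic one.

Two facts determine the remaining waves. Comparing mass fluxes along the waves shows that the state
`U₆` behind the 1-waves moves faster than `U₁` if its pressure does not exceed that of `U₁`, so the
3-wave is a shock. Heated gas is lighter than gas shocked from `U₁` to the same pressure
(`IsHeating.belowHugoniot`, `IsHeating.belowHugoniot_of_shock`), and isentropic expansion preserves
this (`BelowHugoniot.of_isentropic`), so the 3-shock cannot connect to `U₆` without a contact. -/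

noncomputable section

open State

/-! ### Sound speed, Mach number and mirror images -/

namespace State

theorem sound_pos {γ : ℝ} (hγ : 1 < γ) {V : State} (hV : V.IsPhysical) : 0 < V.sound γ := by
  obtain ⟨h1, h2⟩ := hV
  exact Real.sqrt_pos.2 (by positivity)

theorem rho_mul_sound_sq {γ : ℝ} (hγ : 1 < γ) {V : State} (hV : V.IsPhysical) :
    V.rho * V.sound γ ^ 2 = γ * V.pres := by
  obtain ⟨h1, h2⟩ := hV
  rw [sound, Real.sq_sqrt (by positivity)]
  field_simp

theorem sound_eq_of_sq {γ w : ℝ} (hγ : 1 < γ) {V : State} (hV : V.IsPhysical) (hw : 0 < w)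
    (h : V.rho * w ^ 2 = γ * V.pres) : V.sound γ = w := by
  have h1 : V.rho * V.sound γ ^ 2 = V.rho * w ^ 2 := by rw [rho_mul_sound_sq hγ hV, h]
  have h2 := mul_left_cancel₀ hV.1.ne' h1
  exact (pow_left_inj₀ (sound_pos hγ hV).le hw.le two_ne_zero).1 h2

theorem mach_eq_sqrt {γ : ℝ} (hγ : 1 < γ) {V : State} (hV : V.IsPhysical) :
    V.mach γ = Real.sqrt (V.rho * V.vel ^ 2 / (γ * V.pres)) := by
  have ha := sound_pos hγ hV
  have h := rho_mul_sound_sq hγ hV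
  have hr := hV.1
  rw [← h, mach, mul_div_mul_left _ _ hr.ne', Real.sqrt_div (sq_nonneg _), Real.sqrt_sq_eq_abs,
    Real.sqrt_sq ha.le]

theorem mach_lt_mach_iff {γ : ℝ} (hγ : 1 < γ) {V W : State} (hV : V.IsPhysical)
    (hW : W.IsPhysical) : V.mach γ < W.mach γ ↔
      V.rho * V.vel ^ 2 * W.pres < W.rho * W.vel ^ 2 * V.pres := by
  obtain ⟨h1, h2⟩ := hV
  obtain ⟨h3, h4⟩ := hW
  rw [mach_eq_sqrt hγ ⟨h1, h2⟩, mach_eq_sqrt hγ ⟨h3, h4⟩, Real.sqrt_lt_sqrt_iff (by positivity),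
    div_lt_div_iff₀ (by positivity) (by positivity)]
  have : 0 < γ := by linarith
  constructor <;> intro h <;> nlinarith

theorem mach_lt_one_iff {γ : ℝ} (hγ : 1 < γ) {V : State} (hV : V.IsPhysical) :
    V.mach γ < 1 ↔ V.rho * V.vel ^ 2 < γ * V.pres := by
  obtain ⟨h1, h2⟩ := hV
  have : 0 < γ * V.pres := by positivity
  rw [mach_eq_sqrt hγ ⟨h1, h2⟩, Real.sqrt_lt' one_pos, one_pow, div_lt_one this]

theorem one_lt_mach_iff {γ : ℝ} (hγ : 1 < γ) {V : State} (hV : V.IsPhysical) :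
    1 < V.mach γ ↔ γ * V.pres < V.rho * V.vel ^ 2 := by
  obtain ⟨h1, h2⟩ := hV
  have : 0 < γ * V.pres := by positivity
  rw [mach_eq_sqrt hγ ⟨h1, h2⟩, Real.lt_sqrt zero_le_one, one_pow, one_lt_div this]

theorem mach_lt_one_iff_char1 {γ : ℝ} (hγ : 1 < γ) {V : State} (hV : V.IsPhysical)
    (hu : 0 < V.vel) : V.mach γ < 1 ↔ V.char1 γ < 0 := by
  rw [mach, abs_of_pos hu, div_lt_one (sound_pos hγ hV), char1, sub_neg]

theorem one_lt_mach_iff_char1 {γ : ℝ} (hγ : 1 < γ) {V : State} (hV : V.IsPhysical)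
    (hu : 0 < V.vel) : 1 < V.mach γ ↔ 0 < V.char1 γ := by
  rw [mach, abs_of_pos hu, one_lt_div (sound_pos hγ hV), char1, sub_pos]

/-- The mirror image of a state. -/
def reflect (V : State) : State := (V.rho, -V.vel, V.pres)

@[simp] theorem rho_reflect (V : State) : V.reflect.rho = V.rho := rfl
@[simp] theorem vel_reflect (V : State) : V.reflect.vel = -V.vel := rfl
@[simp] theorem pres_reflect (V : State) : V.reflect.pres = V.pres := rfl

@[simp] theorem reflect_reflect (V : State) : V.reflect.reflect = V := by
  simp [reflect, rho, vel, pres]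

theorem reflect_injective : Function.Injective reflect :=
  fun V W h => by rw [← reflect_reflect V, h, reflect_reflect]

theorem isPhysical_reflect {V : State} : V.reflect.IsPhysical ↔ V.IsPhysical := Iff.rfl

@[simp] theorem sound_reflect (γ : ℝ) (V : State) : V.reflect.sound γ = V.sound γ := rfl

@[simp] theorem char1_reflect (γ : ℝ) (V : State) : V.reflect.char1 γ = -V.char3 γ := by
  simp only [char1, char3, vel_reflect, sound_reflect]; ring

@[simp] theorem char3_reflect (γ : ℝ) (V : State) : V.reflect.char3 γ = -V.char1 γ := by
  simp only [char1, char3, vel_reflect, sound_reflect]; ring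

theorem mach_reflect (γ : ℝ) (V : State) : V.reflect.mach γ = V.mach γ := by
  simp only [mach, vel_reflect, sound_reflect, abs_neg]

theorem continuous_reflect : Continuous reflect := by
  unfold reflect rho vel pres
  fun_prop

end State

/-! ### Jump relations for shocks and contacts -/

theorem rankineHugoniot_iff {γ : ℝ} {L R : State} {s : ℝ} : RankineHugoniot γ L R s ↔
    R.rho * R.vel - L.rho * L.vel = s * (R.rho - L.rho) ∧
    (R.rho * R.vel ^ 2 + R.pres) - (L.rho * L.vel ^ 2 + L.pres)
      = s * (R.rho * R.vel - L.rho * L.vel) ∧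
    (R.energy γ + R.pres) * R.vel - (L.energy γ + L.pres) * L.vel
      = s * (R.energy γ - L.energy γ) := by
  simp [RankineHugoniot, flux, cons, Prod.ext_iff]

theorem RankineHugoniot.reflect {γ : ℝ} {L R : State} {s : ℝ} (h : RankineHugoniot γ L R s) :
    RankineHugoniot γ R.reflect L.reflect (-s) := by
  rw [rankineHugoniot_iff] at *
  simp only [energy, rho_reflect, vel_reflect, pres_reflect] at *
  obtain ⟨h1, h2, h3⟩ := h
  refine ⟨?_, ?_, ?_⟩
  · linear_combination h1
  · linear_combination -h2
  · linear_combination h3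

theorem IsShock1.reflect {γ : ℝ} {L R : State} {s : ℝ} (h : IsShock1 γ L R s) :
    IsShock3 γ R.reflect L.reflect (-s) := by
  obtain ⟨h1, h2, h3, h4⟩ := h
  refine ⟨h1.reflect, ?_, ?_, ?_⟩
  · simpa using h4
  · simpa using h3
  · simpa using h2

theorem IsShock3.reflect {γ : ℝ} {L R : State} {s : ℝ} (h : IsShock3 γ L R s) :
    IsShock1 γ R.reflect L.reflect (-s) := by
  obtain ⟨h1, h2, h3, h4⟩ := h
  refine ⟨h1.reflect, ?_, ?_, ?_⟩
  · simpa using h4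
  · simpa using h3
  · simpa using h2

theorem IsContact.reflect {γ : ℝ} {L R : State} {s : ℝ} (h : IsContact γ L R s) :
    IsContact γ R.reflect L.reflect (-s) := by
  obtain ⟨h1, h2, h3, h4⟩ := h
  refine ⟨h1.reflect, ?_, ?_, ?_⟩
  · simpa using h3
  · simpa using h2
  · exact fun e => h4 (reflect_injective e).symm

theorem IsContact.pres_eq {γ : ℝ} {L R : State} {s : ℝ} (h : IsContact γ L R s) :
    L.pres = R.pres := by
  obtain ⟨h1, h2, h3, -⟩ := h
  obtain ⟨h4, h5, -⟩ := rankineHugoniot_iff.1 h1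
  rw [h2, h3] at h5
  linear_combination -h5

theorem IsContact.vel_eq {γ : ℝ} {L R : State} {s : ℝ} (h : IsContact γ L R s) :
    L.vel = R.vel := h.2.1.trans h.2.2.1.symm

/-- The mass flux through a 1-shock, and the jump relations written with it. -/
theorem IsShock1.relations {γ : ℝ} (hγ : 1 < γ) {L R : State} {s : ℝ} (hL : L.IsPhysical)
    (hR : R.IsPhysical) (h : IsShock1 γ L R s) :
    ∃ j > 0, j = L.rho * (L.vel - s) ∧ j = R.rho * (R.vel - s) ∧
      R.pres - L.pres = j * (L.vel - R.vel) ∧ L.pres < R.pres ∧ R.vel < L.vel ∧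
      2 * j ^ 2 = L.rho * ((γ + 1) * R.pres + (γ - 1) * L.pres) ∧
      R.rho * ((γ - 1) * R.pres + (γ + 1) * L.pres)
        = L.rho * ((γ + 1) * R.pres + (γ - 1) * L.pres) := by
  obtain ⟨h0, h1, h2, h3⟩ := h
  obtain ⟨e1, e2, e3⟩ := rankineHugoniot_iff.1 h0
  have aL := sound_pos hγ hL
  have aR := sound_pos hγ hR
  have sL := rho_mul_sound_sq hγ hL
  have sR := rho_mul_sound_sq hγ hR
  obtain ⟨rL, pL⟩ := hL
  obtain ⟨rR, pR⟩ := hR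
  simp only [char1] at h1 h2
  -- `v` and `w` are the velocities in the frame of the shock.
  obtain ⟨v, hv⟩ : ∃ v, v = L.vel - s := ⟨_, rfl⟩
  obtain ⟨w, hw⟩ : ∃ w, w = R.vel - s := ⟨_, rfl⟩
  have hv0 : L.sound γ < v := by linarith
  have hw0 : 0 < w := by linarith
  have hw1 : w < R.sound γ := by linarith
  have hLv : L.vel = v + s := by linarith
  have hRw : R.vel = w + s := by linarith
  simp only [energy, hLv, hRw] at e1 e2 e3
  have hj : L.rho * v = R.rho * w := by linear_combination -e1
  have hm : R.pres - L.pres = L.rho * v * (v - w) := by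
    linear_combination e2 - s * e1 + w * hj
  have hLs : γ * L.pres < L.rho * v * v := by
    have : L.sound γ ^ 2 < v ^ 2 := by gcongr
    nlinarith
  have hRs : L.rho * v * w < γ * R.pres := by
    have : w ^ 2 < R.sound γ ^ 2 := by gcongr
    rw [hj]
    nlinarith
  have hjpos : 0 < L.rho * v := mul_pos rL (aL.trans hv0)
  -- The Lax inequalities make the flow supersonic ahead and subsonic behind. A pressure drop would
  -- then force `w < v`, which by momentum balance means a pressure rise.
  have hp : L.pres < R.pres := by
    by_contra hc
    push Not at hc
    have h4 : γ * R.pres ≤ γ * L.pres := by gcongr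
    have h5 : L.rho * v * w < L.rho * v * v := by linarith
    nlinarith
  have hvw : w < v := by
    by_contra hc
    push Not at hc
    have : L.rho * v * (v - w) ≤ 0 := mul_nonpos_of_nonneg_of_nonpos hjpos.le (by linarith)
    linarith
  have hg : γ - 1 ≠ 0 := by linarith
  have e3' : γ * (R.pres * w - L.pres * v) + (γ - 1) / 2 * (L.rho * v) * (w ^ 2 - v ^ 2) = 0 := by
    field_simp at e3
    linear_combination (1 / 2) * e3 - (γ - 1) * s * e2 + (1 / 2) * s ^ 2 * (γ - 1) * e1
      + (γ - 1) / 2 * w ^ 2 * hj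
  have hH : w * ((γ + 1) * R.pres + (γ - 1) * L.pres)
      = v * ((γ + 1) * L.pres + (γ - 1) * R.pres) := by
    linear_combination 2 * e3' - (γ - 1) * (w + v) * hm
  have hne : v - w ≠ 0 := by linarith
  refine ⟨L.rho * v, hjpos, by rw [hv], by rw [← hw, hj], by rw [hm, hLv, hRw]; ring, hp,
    by linarith, ?_, ?_⟩
  · have : L.rho * v * 2 * v = (γ + 1) * R.pres + (γ - 1) * L.pres := by
      apply mul_right_cancel₀ hne
      linear_combination hH - 2 * v * hm
    linear_combination L.rho * this
  · apply mul_left_cancel₀ hw0.ne'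
    linear_combination -((γ - 1) * R.pres + (γ + 1) * L.pres) * hj - L.rho * hH

theorem IsShock3.relations {γ : ℝ} (hγ : 1 < γ) {L R : State} {s : ℝ} (hL : L.IsPhysical)
    (hR : R.IsPhysical) (h : IsShock3 γ L R s) :
    R.pres < L.pres ∧ R.vel < L.vel ∧ L.rho * ((γ - 1) * L.pres + (γ + 1) * R.pres)
        = R.rho * ((γ + 1) * L.pres + (γ - 1) * R.pres) := by
  obtain ⟨j, -, -, -, -, h1, h2, -, h3⟩ := h.reflect.relations hγ
    (isPhysical_reflect.2 hR) (isPhysical_reflect.2 hL)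
  simp only [rho_reflect, vel_reflect, pres_reflect] at *
  exact ⟨h1, by linarith, h3⟩

/-! ### The heating discontinuity -/

theorem IsHeating.relations {γ Q : ℝ} (hγ : 1 < γ) {V W : State} (h : IsHeating γ Q V W) :
    V.rho * V.vel = W.rho * W.vel ∧
    V.pres - W.pres = V.rho * V.vel * (W.vel - V.vel) ∧
    γ * (W.pres * W.vel - V.pres * V.vel) + (γ - 1) / 2 * (V.rho * V.vel) * (W.vel ^ 2 - V.vel ^ 2)
      = (γ - 1) * Q := by
  have h1 := h.balance
  simp only [flux, energy, Prod.ext_iff, Prod.fst_add, Prod.snd_add] at h1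
  obtain ⟨e1, e2, e3⟩ := h1
  have hg : γ - 1 ≠ 0 := by linarith
  have e1' : V.rho * V.vel = W.rho * W.vel := by linear_combination e1
  refine ⟨e1', by linear_combination e2 - W.vel * e1', ?_⟩
  field_simp at e3
  linear_combination -(1 / 2) * e3 + (γ - 1) / 2 * W.vel ^ 2 * e1'

theorem IsHeating.vel_pos_iff {γ Q : ℝ} (hγ : 1 < γ) {V W : State} (hV : V.IsPhysical)
    (hW : W.IsPhysical) (h : IsHeating γ Q V W) : 0 < V.vel ↔ 0 < W.vel := by
  have hm := (h.relations hγ).1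
  rw [← mul_pos_iff_of_pos_left hV.1, hm, mul_pos_iff_of_pos_left hW.1]

theorem IsHeating.reflect {γ Q : ℝ} (hγ : 1 < γ) {V W : State} (hV : V.IsPhysical)
    (hW : W.IsPhysical) (h : IsHeating γ Q V W) : IsHeating γ Q W.reflect V.reflect := by
  have hs := h.vel_pos_iff hγ hV hW
  obtain ⟨h1, h2, h3, h4, h5⟩ := h
  refine ⟨?_, by simpa using h3, by simpa using h2, ?_, ?_⟩
  · simp only [flux, energy, Prod.ext_iff, Prod.fst_add, Prod.snd_add, rho_reflect, vel_reflect,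
      pres_reflect] at h1 ⊢
    obtain ⟨e1, e2, e3⟩ := h1
    exact ⟨by linear_combination e1, by linear_combination -e2, by linear_combination e3⟩
  · simp only [mach_reflect, vel_reflect, neg_pos]
    intro hu
    exact h5 (lt_of_le_of_ne (not_lt.1 (mt hs.1 hu.not_gt)) h2)
  · simp only [mach_reflect, vel_reflect, neg_neg_iff_pos]
    exact fun hu => h4 (hs.2 hu)

/-- Heating at positive velocity drives the Mach number towards `1`. -/
theorem IsHeating.subsonic_or_supersonic {γ Q : ℝ} (hγ : 1 < γ) (hQ : 0 < Q) {V W : State}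
    (hV : V.IsPhysical) (hW : W.IsPhysical) (h : IsHeating γ Q V W) (hu : 0 < V.vel) :
    (V.mach γ < 1 ∧ W.mach γ ≤ 1 ∧ V.mach γ < W.mach γ ∧ W.pres < V.pres ∧ V.vel < W.vel) ∨
    (1 < V.mach γ ∧ 1 ≤ W.mach γ ∧ W.mach γ < V.mach γ ∧ V.pres < W.pres ∧ W.vel < V.vel) := by
  have hw := (h.vel_pos_iff hγ hV hW).1 hu
  obtain ⟨e1, e2, e3⟩ := h.relations hγ
  obtain ⟨b1, b2⟩ := h.branch_pos hu
  have hm : 0 < V.rho * V.vel := mul_pos hV.1 hu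
  have hm' : 0 < W.rho * W.vel := mul_pos hW.1 hw
  have hVp := hV.2
  have hWp := hW.2
  -- Eliminating the pressure jump factors the energy balance: the velocity jump times a sum of two
  -- terms, each vanishing exactly at Mach number 1. The branch condition gives both terms the same
  -- sign, and `Q > 0` then fixes the sign of the velocity jump.
  have key : (W.vel - V.vel) * ((γ * V.pres - V.rho * V.vel ^ 2)
      + (γ * W.pres - W.rho * W.vel ^ 2)) = 2 * (γ - 1) * Q := by
    linear_combination 2 * e3 + γ * (W.vel + V.vel) * e2 + (W.vel - V.vel) * W.vel * e1
  have hq : 0 < 2 * (γ - 1) * Q := by have : 0 < γ - 1 := by linarith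
                                      positivity
  rcases lt_trichotomy (V.mach γ) 1 with h1 | h1 | h1
  · left
    have hW1 := b1 h1
    have c1 := (mach_lt_one_iff hγ hV).1 h1
    have c2 := not_lt.1 (mt (one_lt_mach_iff hγ hW).2 hW1.not_gt)
    have huv : 0 < W.vel - V.vel :=
      pos_of_mul_pos_left (by rw [key]; exact hq) (by linarith)
    have hp : W.pres < V.pres := by
      have := mul_pos hm huv
      linarith
    refine ⟨h1, hW1, ?_, hp, by linarith⟩
    rw [mach_lt_mach_iff hγ hV hW]
    calc V.rho * V.vel ^ 2 * W.pres = V.rho * V.vel * (V.vel * W.pres) := by ring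
      _ < V.rho * V.vel * (W.vel * V.pres) := by gcongr; linarith
      _ = W.rho * W.vel ^ 2 * V.pres := by linear_combination W.vel * V.pres * e1
  -- Sonic inflow cannot be heated: the left side of `key` becomes a nonpositive multiple of a
  -- square.
  · exfalso
    have c1 : γ * V.pres - V.rho * V.vel ^ 2 = 0 := by
      have i1 := not_lt.1 (mt (mach_lt_one_iff hγ hV).2 h1.not_lt)
      have i2 := not_lt.1 (mt (one_lt_mach_iff hγ hV).2 h1.not_gt)
      linarith
    have c2 : γ * W.pres - W.rho * W.vel ^ 2 = -(γ + 1) * (V.rho * V.vel) * (W.vel - V.vel) := by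
      linear_combination c1 - γ * e2 + W.vel * e1
    rw [c1, c2] at key
    have : 0 ≤ (γ + 1) * (V.rho * V.vel) * (W.vel - V.vel) ^ 2 := by positivity
    linarith
  · right
    have hW1 := b2 h1
    have c1 := (one_lt_mach_iff hγ hV).1 h1
    have c2 := not_lt.1 (mt (mach_lt_one_iff hγ hW).2 hW1.not_gt)
    have huv : 0 < V.vel - W.vel := by
      by_contra hc
      have := mul_nonpos_of_nonneg_of_nonpos (show 0 ≤ W.vel - V.vel by linarith)
        (show (γ * V.pres - V.rho * V.vel ^ 2) + (γ * W.pres - W.rho * W.vel ^ 2) ≤ 0 by linarith)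
      linarith
    have hp : V.pres < W.pres := by
      have := mul_pos hm huv
      linarith
    refine ⟨h1, hW1, ?_, hp, by linarith⟩
    rw [mach_lt_mach_iff hγ hW hV]
    calc W.rho * W.vel ^ 2 * V.pres = V.rho * V.vel * (W.vel * V.pres) := by
          linear_combination -W.vel * V.pres * e1
      _ < V.rho * V.vel * (V.vel * W.pres) := by gcongr; linarith
      _ = V.rho * V.vel ^ 2 * W.pres := by ring

/-! ### Comparison with the Hugoniot curve -/

/-- `V` has smaller density than the point with the same pressure on the Hugoniot curve of `V₁`. -/
def BelowHugoniot (γ : ℝ) (V₁ V : State) : Prop :=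
  V.rho * ((γ - 1) * V.pres + (γ + 1) * V₁.pres) < V₁.rho * ((γ + 1) * V.pres + (γ - 1) * V₁.pres)

/-- Mass, momentum and energy balance combine to the Hugoniot relation with the positive defect `2
(γ - 1) Q`: at given pressure, added heat increases the specific volume. -/
theorem IsHeating.belowHugoniot {γ Q : ℝ} (hγ : 1 < γ) (hQ : 0 < Q) {V W : State}
    (hV : V.IsPhysical) (hW : W.IsPhysical) (h : IsHeating γ Q V W) (hu : 0 < V.vel) :
    BelowHugoniot γ V W := by
  have hw := (h.vel_pos_iff hγ hV hW).1 hu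
  obtain ⟨e1, e2, e3⟩ := h.relations hγ
  have hq : 0 < 2 * (γ - 1) * Q := by have : 0 < γ - 1 := by linarith
                                      positivity
  have key : W.vel * ((γ + 1) * W.pres + (γ - 1) * V.pres)
      - V.vel * ((γ - 1) * W.pres + (γ + 1) * V.pres) = 2 * (γ - 1) * Q := by
    linear_combination 2 * e3 + (γ - 1) * (W.vel + V.vel) * e2
  have hVr := hV.1
  have := mul_pos hVr hq
  rw [← key] at this
  refine lt_of_mul_lt_mul_left (a := W.vel) ?_ hw.le
  linear_combination this - ((γ - 1) * W.pres + (γ + 1) * V.pres) * e1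

/-- Comparison in the plane of specific volume and pressure. If the heated state were at least as
dense as the Hugoniot curve of `V₁`, the Hugoniot functions of the three pairs among `V₁`, `V`, `W`
would sum to a signed triangle area, positive because of the heat; monotone secant slopes of the
Hugoniot curve give this area the opposite sign. -/
theorem IsHeating.belowHugoniot_of_shock {γ Q s : ℝ} (hγ : 1 < γ) (hQ : 0 < Q) {V₁ V W : State}
    (hV₁ : V₁.IsPhysical) (hV : V.IsPhysical) (hW : W.IsPhysical) (hs : IsShock1 γ V₁ V s)
    (h : IsHeating γ Q V W) (hu : 0 < V.vel) (hp : W.pres < V.pres) (hp₁ : V₁.pres < W.pres) :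
    BelowHugoniot γ V₁ W := by
  have hw := (h.vel_pos_iff hγ hV hW).1 hu
  obtain ⟨j, hj, -, -, -, s1, -, s2, s3⟩ := hs.relations hγ hV₁ hV
  obtain ⟨e1, e2, e3⟩ := h.relations hγ
  have hg : 0 < γ - 1 := by linarith
  have hq : 0 < 2 * (γ - 1) * Q := by positivity
  obtain ⟨r1, p1⟩ := hV₁
  obtain ⟨r4, p4⟩ := hV
  obtain ⟨r5, p5⟩ := hW
  by_contra hc
  simp only [BelowHugoniot, not_lt] at hc
  have hm : 0 < V.rho * V.vel := mul_pos r4 hu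
  obtain ⟨m, hm'⟩ : ∃ m, m = V.rho * V.vel := ⟨_, rfl⟩
  -- The `t`s are specific volumes. The mass flux `m` is common to `V` and `W`, so their velocities
  -- are `m` times these.
  obtain ⟨t₁, ht₁⟩ : ∃ t, t * V₁.rho = 1 := ⟨1 / V₁.rho, by field_simp⟩
  obtain ⟨t₄, ht₄⟩ : ∃ t, t * V.rho = 1 := ⟨1 / V.rho, by field_simp⟩
  obtain ⟨t₅, ht₅⟩ : ∃ t, t * W.rho = 1 := ⟨1 / W.rho, by field_simp⟩
  have ht₁0 : 0 < t₁ := pos_of_mul_pos_left (by rw [ht₁]; exact one_pos) r1.le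
  have ht₄0 : 0 < t₄ := pos_of_mul_pos_left (by rw [ht₄]; exact one_pos) r4.le
  have ht₅0 : 0 < t₅ := pos_of_mul_pos_left (by rw [ht₅]; exact one_pos) r5.le
  have hV4 : V.vel = m * t₄ := by linear_combination -t₄ * hm' - V.vel * ht₄
  have hW5 : W.vel = m * t₅ := by linear_combination -t₅ * (hm'.trans e1) - W.vel * ht₅
  rw [← hm'] at e2 e3 hm
  rw [hV4, hW5] at e2 e3
  have key : 0 < 2 * γ * (W.pres * t₅ - V.pres * t₄)
      + (γ - 1) * ((V.pres - W.pres) * (t₅ + t₄)) := by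
    refine pos_of_mul_pos_right (a := m) ?_ hm.le
    linear_combination hq - 2 * e3 - (γ - 1) * m * (t₅ + t₄) * e2
  have k1 : t₁ * ((γ - 1) * V.pres + (γ + 1) * V₁.pres)
      = t₄ * ((γ + 1) * V.pres + (γ - 1) * V₁.pres) := by
    linear_combination t₁ * t₄ * s3 - t₁ * ((γ - 1) * V.pres + (γ + 1) * V₁.pres) * ht₄
      + t₄ * ((γ + 1) * V.pres + (γ - 1) * V₁.pres) * ht₁
  have k2 : t₅ * ((γ + 1) * W.pres + (γ - 1) * V₁.pres)
      ≤ t₁ * ((γ - 1) * W.pres + (γ + 1) * V₁.pres) := by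
    have := mul_le_mul_of_nonneg_left hc (mul_pos ht₁0 ht₅0).le
    linear_combination this + t₁ * ((γ - 1) * W.pres + (γ + 1) * V₁.pres) * ht₅
      - t₅ * ((γ + 1) * W.pres + (γ - 1) * V₁.pres) * ht₁
  generalize V₁.pres = q₁ at *
  generalize V.pres = q₄ at *
  generalize W.pres = q₅ at *
  -- On the Hugoniot curve, `(t₁ - t) / (q - q₁)` equals `2 t₁ / ((γ + 1) q + (γ - 1) q₁)`, which
  -- decreases in `q`. The state `W` has at least this secant slope at `q₅`, and `q₅ < q₄`.
  have k3 : 2 * t₁ * (q₅ - q₁) ≤ (t₁ - t₅) * ((γ + 1) * q₅ + (γ - 1) * q₁) := by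
    linear_combination k2
  have k5 : 0 < t₁ - t₅ := by
    refine pos_of_mul_pos_left (b := (γ + 1) * q₅ + (γ - 1) * q₁) (lt_of_lt_of_le ?_ k3)
      (by positivity)
    have : 0 < q₅ - q₁ := by linarith
    positivity
  -- Up to the factor `γ - 1`, this is twice the signed area of the triangle of the three states.
  have k6 : 0 < (γ - 1) * ((q₅ - q₁) * (t₁ - t₄) - (q₄ - q₁) * (t₁ - t₅)) := by
    linear_combination key + k1 + k2
  have k7 := pos_of_mul_pos_right k6 hg.le
  have k8 := mul_pos k7 (show 0 < (γ + 1) * q₄ + (γ - 1) * q₁ by positivity)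
  have k9 : (t₁ - t₅) * ((γ + 1) * q₅ + (γ - 1) * q₁)
      ≤ (t₁ - t₅) * ((γ + 1) * q₄ + (γ - 1) * q₁) := by gcongr
  have k10 := mul_le_mul_of_nonneg_left (k3.trans k9) (show 0 ≤ q₄ - q₁ by linarith)
  have k11 : (q₅ - q₁) * (t₁ - t₄) * ((γ + 1) * q₄ + (γ - 1) * q₁)
      = (q₅ - q₁) * (2 * t₁ * (q₄ - q₁)) := by linear_combination (q₅ - q₁) * k1
  linarith

/-- Along an isentrope, the ratio of the density to the Hugoniot density at the same pressure is
nondecreasing in the pressure. Its logarithm is, up to a constant, `g / γ` with the `g` below, whose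
derivative is a nonnegative multiple of `(p - q₁) ^ 2`. No comparison of the pressures with that of
`V₁` is needed. -/
theorem BelowHugoniot.of_isentropic {γ : ℝ} (hγ : 1 < γ) {V₁ V W : State} (hV₁ : V₁.IsPhysical)
    (hV : V.IsPhysical) (hW : W.IsPhysical) (h : BelowHugoniot γ V₁ V)
    (hp : W.pres ≤ V.pres) (hS : W.pres / W.rho ^ γ = V.pres / V.rho ^ γ) :
    BelowHugoniot γ V₁ W := by
  obtain ⟨r1, p1⟩ := hV₁
  obtain ⟨r4, p4⟩ := hV
  obtain ⟨r5, p5⟩ := hW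
  have hγ0 : 0 < γ - 1 := by linarith
  have hγ1 : 0 < γ + 1 := by linarith
  have hγ2 : 0 < γ := by linarith
  unfold BelowHugoniot at *
  generalize V₁.rho = r₁ at *
  generalize V.rho = r₄ at *
  generalize W.rho = r₅ at *
  generalize V₁.pres = q₁ at *
  generalize V.pres = q₄ at *
  generalize W.pres = q₅ at *
  let A : ℝ → ℝ := fun p => (γ + 1) * p + (γ - 1) * q₁
  let B : ℝ → ℝ := fun p => (γ - 1) * p + (γ + 1) * q₁
  have hA : ∀ p > 0, 0 < A p := fun p hp => by simp only [A]; positivity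
  have hB : ∀ p > 0, 0 < B p := fun p hp => by simp only [B]; positivity
  let g : ℝ → ℝ := fun p => Real.log p - γ * (Real.log (A p) - Real.log (B p))
  have hd : ∀ p > 0, HasDerivAt g (1 / p - γ * ((γ + 1) / A p - (γ - 1) / B p)) p := by
    intro p hp
    have dA : HasDerivAt A (γ + 1) p := by
      simpa [A] using ((hasDerivAt_id p).const_mul (γ + 1)).add_const ((γ - 1) * q₁)
    have dB : HasDerivAt B (γ - 1) p := by
      simpa [B] using ((hasDerivAt_id p).const_mul (γ - 1)).add_const ((γ + 1) * q₁)
    have dl := (hasDerivAt_id p).log hp.ne'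
    exact dl.sub (((dA.log (hA p hp).ne').sub (dB.log (hB p hp).ne')).const_mul γ)
  have mono : MonotoneOn g (Ioi 0) := by
    apply monotoneOn_of_deriv_nonneg (convex_Ioi 0)
    · exact fun p hp => (hd p hp).continuousAt.continuousWithinAt
    · rw [interior_Ioi]
      exact fun p hp => (hd p hp).differentiableAt.differentiableWithinAt
    · rw [interior_Ioi]
      intro p hp
      have hp' : 0 < p := hp
      have h1 := hA p hp
      have h2 := hB p hp
      rw [(hd p hp).deriv]
      have : 1 / p - γ * ((γ + 1) / A p - (γ - 1) / B p)
          = (γ ^ 2 - 1) * (p - q₁) ^ 2 / (p * A p * B p) := by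
        field_simp
        simp only [A, B]
        ring
      rw [this]
      have : 0 < γ ^ 2 - 1 := by nlinarith
      positivity
  have hm := mono (show q₅ ∈ Ioi 0 from p5) (show q₄ ∈ Ioi 0 from p4) hp
  have hl := congrArg Real.log hS
  rw [Real.log_div p5.ne' (by positivity), Real.log_div p4.ne' (by positivity),
    Real.log_rpow r5, Real.log_rpow r4] at hl
  have h4 : Real.log (r₄ * B q₄) < Real.log (r₁ * A q₄) :=
    Real.log_lt_log (mul_pos r4 (hB _ p4)) h
  rw [Real.log_mul r4.ne' (hB _ p4).ne', Real.log_mul r1.ne' (hA _ p4).ne'] at h4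
  change r₅ * B q₅ < r₁ * A q₅
  rw [← Real.log_lt_log_iff (mul_pos r5 (hB _ p5)) (mul_pos r1 (hA _ p5)),
    Real.log_mul r5.ne' (hB _ p5).ne', Real.log_mul r1.ne' (hA _ p5).ne']
  simp only [g] at hm
  nlinarith

theorem IsShock3.not_belowHugoniot {γ s : ℝ} (hγ : 1 < γ) {L R : State} (hL : L.IsPhysical)
    (hR : R.IsPhysical) (h : IsShock3 γ L R s) : ¬ BelowHugoniot γ R L :=
  not_lt.2 (h.relations hγ hL hR).2.2.ge

/-! ### Rarefaction waves of the first family -/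

/-- The pressure is a strictly convex function of the velocity along the wave, with slope `-ρ a` at
the left state; the last estimate is the tangent line inequality. -/
theorem IsRarefaction1.relations {γ : ℝ} (hγ : 1 < γ) {L R : State} (hL : L.IsPhysical)
    (hR : R.IsPhysical) (h : IsRarefaction1 γ L R) (hc : L.char1 γ < R.char1 γ) :
    L.vel < R.vel ∧ R.pres < L.pres ∧
      L.pres - R.pres < L.rho * L.sound γ * (R.vel - L.vel) := by
  obtain ⟨⟨h1, h2⟩, -⟩ := h
  have aL := sound_pos hγ hL
  have aR := sound_pos hγ hR
  have sL := rho_mul_sound_sq hγ hL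
  have sR := rho_mul_sound_sq hγ hR
  obtain ⟨rL, pL⟩ := hL
  obtain ⟨rR, pR⟩ := hR
  have hγ0 : 0 < γ - 1 := by linarith
  have hγ2 : 0 < γ := by linarith
  simp only [char1] at hc
  generalize L.sound γ = a at *
  generalize R.sound γ = b at *
  generalize L.rho = r at *
  generalize R.rho = r' at *
  generalize L.pres = p at *
  generalize R.pres = p' at *
  have hu : R.vel - L.vel = 2 / (γ - 1) * (a - b) := by
    linear_combination h1
  have hab : b < a := by
    by_contra hn
    have : 2 / (γ - 1) * (a - b) ≤ 0 :=
      mul_nonpos_of_nonneg_of_nonpos (by positivity) (by linarith)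
    linarith
  have hup : 0 < 2 / (γ - 1) * (a - b) := mul_pos (by positivity) (by linarith)
  have hl := congrArg Real.log h2
  rw [Real.log_div pR.ne' (by positivity), Real.log_div pL.ne' (by positivity),
    Real.log_rpow rR, Real.log_rpow rL] at hl
  have l1 := congrArg Real.log sL
  have l2 := congrArg Real.log sR
  rw [Real.log_mul (by positivity) (by positivity), Real.log_mul (by positivity) (by positivity),
    Real.log_pow] at l1 l2
  push_cast at l1 l2
  have hpr : p' = p * (b / a) ^ (2 * γ / (γ - 1)) := by
    apply Real.log_injOn_pos (mem_Ioi.2 pR) (mem_Ioi.2 (by positivity))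
    rw [Real.log_mul pL.ne' (by positivity), Real.log_rpow (by positivity),
      Real.log_div aR.ne' aL.ne']
    field_simp
    linear_combination -hl - γ * (l2 - l1)
  have hba : b / a < 1 := (div_lt_one aL).2 hab
  have hk : 1 < 2 * γ / (γ - 1) := (one_lt_div hγ0).2 (by linarith)
  refine ⟨by linarith, ?_, ?_⟩
  · rw [hpr]
    exact mul_lt_of_lt_one_right pL (Real.rpow_lt_one (by positivity) hba (by linarith))
  -- Bernoulli's inequality for `(b / a) ^ (2 γ / (γ - 1))` is the tangent line inequality in terms
  -- of the sound speed.
  · have hB := one_add_mul_self_lt_rpow_one_add (s := b / a - 1) (by have : 0 < b / a := by positivity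
                                                                     linarith)
      (by linarith) hk
    rw [add_sub_cancel] at hB
    have h3 : r * a * (R.vel - L.vel) = p * (2 * γ / (γ - 1) * (1 - b / a)) := by
      rw [hu]
      field_simp
      linear_combination (a - b) * sL
    rw [h3, hpr]
    nlinarith

/-! ### Smooth self-similar solutions -/

/-- The Euler equations for a self-similar profile `V`, in primitive variables, at the point `ξ`. -/
def SimilarityODE (γ : ℝ) (V : ℝ → State) (ξ : ℝ) : Prop :=
  ∃ d : State, HasDerivAt V d ξ ∧
    ((V ξ).vel - ξ) * d.rho + (V ξ).rho * d.vel = 0 ∧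
    (V ξ).rho * (((V ξ).vel - ξ) * d.vel) + d.pres = 0 ∧
    ((V ξ).vel - ξ) * d.pres + γ * (V ξ).pres * d.vel = 0

theorem HasDerivAt.rho {V : ℝ → State} {d : State} {ξ : ℝ} (h : HasDerivAt V d ξ) :
    HasDerivAt (fun η => (V η).rho) d.rho ξ := by
  have := (hasFDerivAt_fst (𝕜 := ℝ) (p := V ξ)).comp_hasDerivAt ξ h
  exact this

theorem HasDerivAt.vel {V : ℝ → State} {d : State} {ξ : ℝ} (h : HasDerivAt V d ξ) :
    HasDerivAt (fun η => (V η).vel) d.vel ξ := by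
  have := (hasFDerivAt_snd (𝕜 := ℝ) (p := V ξ)).comp_hasDerivAt ξ h
  exact (hasFDerivAt_fst (𝕜 := ℝ) (p := (V ξ).2)).comp_hasDerivAt ξ this

theorem HasDerivAt.pres {V : ℝ → State} {d : State} {ξ : ℝ} (h : HasDerivAt V d ξ) :
    HasDerivAt (fun η => (V η).pres) d.pres ξ := by
  have := (hasFDerivAt_snd (𝕜 := ℝ) (p := V ξ)).comp_hasDerivAt ξ h
  exact (hasFDerivAt_snd (𝕜 := ℝ) (p := (V ξ).2)).comp_hasDerivAt ξ this

/-- Where the velocity of a profile varies, its slope is that of a centered fan. -/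
theorem SimilarityODE.vel_slope {γ : ℝ} (hγ : 1 < γ) {V : ℝ → State} {S : Set ℝ} (hS : IsOpen S)
    (hphys : ∀ ξ ∈ S, (V ξ).IsPhysical) (hc : ContinuousOn (deriv V) S)
    (hode : ∀ ξ ∈ S, SimilarityODE γ V ξ) {ξ : ℝ} (hξ : ξ ∈ S) :
    (deriv V ξ).vel = 0 ∨ (deriv V ξ).vel = 2 / (γ + 1) ∧
      (V ξ).rho * ((V ξ).vel - ξ) ^ 2 = γ * (V ξ).pres := by
  by_cases h0 : (deriv V ξ).vel = 0
  · exact Or.inl h0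
  right
  have sonic : ∀ η ∈ S, (deriv V η).vel ≠ 0 →
      (V η).rho * ((V η).vel - η) ^ 2 = γ * (V η).pres := by
    intro η hη hne
    obtain ⟨d, hd, -, e2, e3⟩ := hode η hη
    rw [hd.deriv] at hne
    apply mul_right_cancel₀ hne
    linear_combination ((V η).vel - η) * e2 - e3
  have hcv : ContinuousAt (fun η => (deriv V η).vel) ξ := by
    have := hc.continuousAt (hS.mem_nhds hξ)
    unfold State.vel
    fun_prop
  -- Where the velocity varies, the linear system for the derivatives is singular. By continuity
  -- this persists near `ξ`, so the sonic relation may be differentiated, and that determines the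
  -- slope.
  have hev : ∀ᶠ η in 𝓝 ξ, (V η).rho * ((V η).vel - η) ^ 2 - γ * (V η).pres = 0 := by
    filter_upwards [hS.mem_nhds hξ, hcv.eventually_ne h0] with η h1 h2
    exact sub_eq_zero.2 (sonic η h1 h2)
  have hson := sonic ξ hξ h0
  refine ⟨?_, hson⟩
  obtain ⟨d, hd, e1, e2, e3⟩ := hode ξ hξ
  rw [hd.deriv] at h0 ⊢
  have hF := ((hd.rho.mul ((hd.vel.sub (hasDerivAt_id ξ)).pow 2)).sub (hd.pres.const_mul γ))
  have hF0 : HasDerivAt (fun η => (V η).rho * ((V η).vel - η) ^ 2 - γ * (V η).pres) 0 ξ :=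
    (hasDerivAt_const ξ (0 : ℝ)).congr_of_eventuallyEq hev
  have hu := hF.unique hF0
  simp at hu
  have hw : (V ξ).vel - ξ ≠ 0 := by
    intro hw
    rw [hw] at hson
    have := (hphys ξ hξ).2
    have : 0 < γ * (V ξ).pres := by positivity
    simp at hson
    rcases hson with h | h <;> linarith
  have hr := (hphys ξ hξ).1
  rw [eq_div_iff (by linarith)]
  have hne : (V ξ).rho * ((V ξ).vel - ξ) ≠ 0 := mul_ne_zero hr.ne' hw
  apply mul_left_cancel₀ hne
  linear_combination hu - ((V ξ).vel - ξ) * e1 + γ * e2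

/-- A smooth self-similar solution is constant or a centered fan of the first or third family. -/
theorem SimilarityODE.const_or_fan {γ : ℝ} (hγ : 1 < γ) {V : ℝ → State} {S : Set ℝ}
    (hS : IsOpen S) (hconv : Convex ℝ S)
    (hphys : ∀ ξ ∈ S, (V ξ).IsPhysical) (hc : ContDiffOn ℝ 1 V S)
    (hode : ∀ ξ ∈ S, SimilarityODE γ V ξ) :
    (∃ W, ∀ ξ ∈ S, V ξ = W) ∨
    ((∀ ξ ∈ S, (V ξ).char1 γ = ξ) ∧ ∀ ξ ∈ S, ∀ η ∈ S, SameInvariants1 γ (V ξ) (V η)) ∨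
    ((∀ ξ ∈ S, (V ξ).char3 γ = ξ) ∧
      ∀ ξ ∈ S, ∀ η ∈ S, ξ < η → (V ξ).vel < (V η).vel ∧ (V ξ).pres < (V η).pres) := by
  have hγ1 : 0 < γ + 1 := by linarith
  have hγm : γ - 1 ≠ 0 := by linarith
  have hpre := hconv.isPreconnected
  have hcd : ContinuousOn (deriv V) S := hc.continuousOn_deriv_of_isOpen hS le_rfl
  have hdiff : ∀ ξ ∈ S, HasDerivAt V (deriv V ξ) ξ := fun ξ hξ => by
    obtain ⟨d, hd, -⟩ := hode ξ hξ
    exact hd.differentiableAt.hasDerivAt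
  have heq : ∀ ξ ∈ S, ((V ξ).vel - ξ) * (deriv V ξ).rho + (V ξ).rho * (deriv V ξ).vel = 0 ∧
      (V ξ).rho * (((V ξ).vel - ξ) * (deriv V ξ).vel) + (deriv V ξ).pres = 0 := fun ξ hξ => by
    obtain ⟨d, hd, e1, e2, e3⟩ := hode ξ hξ
    rw [hd.deriv]
    exact ⟨e1, e2⟩
  have hslope := fun ξ hξ => SimilarityODE.vel_slope hγ hS hphys hcd hode (ξ := ξ) hξ
  have hcv : ContinuousOn (fun η => (deriv V η).vel) S := by
    unfold State.vel
    fun_prop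
  have hcV : ContinuousOn V S := hc.continuousOn
  have hT : IsDiscrete ({0, 2 / (γ + 1)} : Set ℝ) := (Set.toFinite _).isDiscrete
  -- The velocity slope is continuous with values in a two-point set, hence constant on the
  -- interval.
  obtain ⟨k, hk, hkS⟩ := hpre.eqOn_const_of_mapsTo hT hcv
    (fun ξ hξ => by
      rcases hslope ξ hξ with h | ⟨h, -⟩
      · exact Or.inl h
      · exact Or.inr h) ⟨0, by simp⟩
  have hvel : ∀ ξ ∈ S, (deriv V ξ).vel = k := hkS
  have hconst : ∀ f : ℝ → ℝ, (∀ ξ ∈ S, HasDerivAt f 0 ξ) → ∀ ξ ∈ S, ∀ η ∈ S, f η = f ξ :=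
    fun f hf ξ hξ η hη => hS.is_const_of_deriv_eq_zero hpre
      (fun x hx => (hf x hx).differentiableAt.differentiableWithinAt)
      (fun x hx => (hf x hx).deriv) hη hξ
  rcases hk with rfl | rfl
  · left
    rcases S.eq_empty_or_nonempty with rfl | ⟨ξ₀, hξ₀⟩
    · exact ⟨(0 : State), by simp⟩
    refine ⟨V ξ₀, fun ξ hξ => ?_⟩
    have hv := hconst (fun η => (V η).vel) (fun η hη => by
      have := (hdiff η hη).vel
      rwa [hvel η hη] at this)
    have hp := hconst (fun η => (V η).pres) (fun η hη => by
      have h1 := (hdiff η hη).pres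
      have h2 := (heq η hη).2
      rw [hvel η hη] at h2
      rwa [show (deriv V η).pres = 0 by linarith] at h1)
    have hr0 : ∀ η ∈ S, η ≠ (V ξ₀).vel → (deriv V η).rho = 0 := by
      intro η hη hne
      have h2 := (heq η hη).1
      rw [hvel η hη, hv ξ₀ hξ₀ η hη] at h2
      have : (V ξ₀).vel - η ≠ 0 := sub_ne_zero.2 hne.symm
      simpa [this] using h2
    -- The equations leave the density slope free only at the single point where `η` equals the
    -- velocity; continuity settles that point.
    have hr1 : ∀ η ∈ S, (deriv V η).rho = 0 := by
      intro η hη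
      by_contra hne
      have hcr : ContinuousAt (fun η => (deriv V η).rho) η := by
        have := hcd.continuousAt (hS.mem_nhds hη)
        unfold State.rho
        fun_prop
      have hev := (hcr.eventually_ne hne).and (hS.mem_nhds hη)
      have : ∀ᶠ x in 𝓝 η, x = (V ξ₀).vel := by
        filter_upwards [hev] with x hx
        by_contra h
        exact hx.1 (hr0 x hx.2 h)
      have h3 := this.self_of_nhds
      rw [← h3] at this
      have h4 : ∀ᶠ x in 𝓝[≠] η, False := by
        filter_upwards [this.filter_mono nhdsWithin_le_nhds, self_mem_nhdsWithin] with x h5 h6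
        exact h6 h5
      exact (inferInstance : (𝓝[≠] η).NeBot).ne (by simpa using h4)
    have hr := hconst (fun η => (V η).rho) (fun η hη => by
      have := (hdiff η hη).rho
      rwa [hr1 η hη] at this)
    exact Prod.ext (hr ξ₀ hξ₀ ξ hξ) (Prod.ext (hv ξ₀ hξ₀ ξ hξ) (hp ξ₀ hξ₀ ξ hξ))
  · right
    have hkpos : 0 < 2 / (γ + 1) := by positivity
    have hson : ∀ ξ ∈ S, (V ξ).rho * ((V ξ).vel - ξ) ^ 2 = γ * (V ξ).pres := fun ξ hξ => by
      rcases hslope ξ hξ with h | ⟨-, h⟩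
      · rw [hvel ξ hξ] at h
        exact absurd h hkpos.ne'
      · exact h
    have hw : ∀ ξ ∈ S, (V ξ).vel - ξ ≠ 0 := fun ξ hξ h => by
      have h1 := hson ξ hξ
      rw [h] at h1
      have h2 := (hphys ξ hξ).2
      have : 0 < γ * (V ξ).pres := by positivity
      norm_num at h1
      rcases h1 with h1 | h1 <;> linarith
    have hwc : ContinuousOn (fun ξ => (V ξ).vel - ξ) S := by
      unfold State.vel
      fun_prop
    -- The sign of `u - ξ` decides whether `ξ` is the first or the third characteristic speed.
    have hsign : (∀ ξ ∈ S, 0 < (V ξ).vel - ξ) ∨ ∀ ξ ∈ S, (V ξ).vel - ξ < 0 := by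
      by_contra hcon
      push Not at hcon
      obtain ⟨⟨x, hx, hx'⟩, y, hy, hy'⟩ := hcon
      obtain ⟨z, hz, hz'⟩ := hpre.intermediate_value hx hy hwc ⟨hx', hy'⟩
      exact hw z hz hz'
    rcases hsign with hs | hs
    · left
      have hsound : ∀ ξ ∈ S, (V ξ).sound γ = (V ξ).vel - ξ := fun ξ hξ =>
        sound_eq_of_sq hγ (hphys ξ hξ) (hs ξ hξ) (hson ξ hξ)
      refine ⟨fun ξ hξ => by rw [char1, hsound ξ hξ]; ring, fun ξ hξ η hη => ⟨?_, ?_⟩⟩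
      · rw [hsound ξ hξ, hsound η hη]
        refine hconst (fun η => (V η).vel + 2 * ((V η).vel - η) / (γ - 1)) (fun x hx => ?_) ξ hξ η hη
        have hd := (hdiff x hx).vel
        rw [hvel x hx] at hd
        have hd' := hd.add (((hd.sub (hasDerivAt_id x)).const_mul 2).div_const (γ - 1))
        rwa [show 2 / (γ + 1) + 2 * (2 / (γ + 1) - 1) / (γ - 1) = 0 by field_simp; ring] at hd'
      · refine hconst (fun η => (V η).pres / (V η).rho ^ γ) (fun x hx => ?_) ξ hξ η hη
        have hx0 := (hphys x hx).1
        have hd := (hdiff x hx).pres.div ((hdiff x hx).rho.rpow_const (p := γ) (Or.inl hx0.ne'))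
          (by positivity)
        have : (deriv V x).pres * (V x).rho ^ γ
            - (V x).pres * ((deriv V x).rho * γ * (V x).rho ^ (γ - 1)) = 0 := by
          rw [Real.rpow_sub_one hx0.ne']
          field_simp
          obtain ⟨e1, e2⟩ := heq x hx
          have e3 := hson x hx
          have : (V x).rho * (deriv V x).pres - γ * (V x).pres * (deriv V x).rho = 0 := by
            linear_combination (V x).rho * e2 + (deriv V x).rho * e3 - (V x).rho * ((V x).vel - x) * e1
          linear_combination (V x).rho ^ γ * this
        rwa [this, zero_div] at hd
    · right
      have hsound : ∀ ξ ∈ S, (V ξ).sound γ = ξ - (V ξ).vel := fun ξ hξ =>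
        sound_eq_of_sq hγ (hphys ξ hξ) (by linarith [hs ξ hξ])
          (by linear_combination hson ξ hξ)
      refine ⟨fun ξ hξ => by rw [char3, hsound ξ hξ]; ring, fun ξ hξ η hη hlt => ⟨?_, ?_⟩⟩
      · refine strictMonoOn_of_deriv_pos hconv
          (fun x hx => (hdiff x hx).vel.continuousAt.continuousWithinAt) (fun x hx => ?_) hξ hη hlt
        rw [hS.interior_eq] at hx
        rw [(hdiff x hx).vel.deriv, hvel x hx]
        exact hkpos
      · refine strictMonoOn_of_deriv_pos hconv
          (fun x hx => (hdiff x hx).pres.continuousAt.continuousWithinAt) (fun x hx => ?_) hξ hη hlt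
        rw [hS.interior_eq] at hx
        have e2 := (heq x hx).2
        rw [hvel x hx] at e2
        rw [(hdiff x hx).pres.deriv, show (deriv V x).pres
          = (V x).rho * (-((V x).vel - x) * (2 / (γ + 1))) by linear_combination e2]
        have h1 := (hphys x hx).1
        have h2 : 0 < -((V x).vel - x) := by linarith [hs x hx]
        positivity

/-! ### Continuity and limits of characteristic speeds and invariants -/

namespace State

theorem continuous_rho : Continuous rho := by unfold rho; fun_prop
theorem continuous_vel : Continuous vel := by unfold vel; fun_prop
theorem continuous_pres : Continuous pres := by unfold pres; fun_prop

theorem continuousAt_sound (γ : ℝ) {V : State} (hV : V.IsPhysical) :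
    ContinuousAt (sound γ) V :=
  Real.continuous_sqrt.continuousAt.comp
    ((continuousAt_const.mul continuous_pres.continuousAt).div continuous_rho.continuousAt
      hV.1.ne')

theorem continuousAt_char1 (γ : ℝ) {V : State} (hV : V.IsPhysical) : ContinuousAt (char1 γ) V :=
  continuous_vel.continuousAt.sub (continuousAt_sound γ hV)

theorem continuousAt_char3 (γ : ℝ) {V : State} (hV : V.IsPhysical) : ContinuousAt (char3 γ) V :=
  continuous_vel.continuousAt.add (continuousAt_sound γ hV)

end State

theorem SameInvariants1.trans {γ : ℝ} {V W X : State} (h : SameInvariants1 γ V W)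
    (h' : SameInvariants1 γ W X) : SameInvariants1 γ V X :=
  ⟨h'.1.trans h.1, h'.2.trans h.2⟩

theorem SameInvariants1.symm {γ : ℝ} {V W : State} (h : SameInvariants1 γ V W) :
    SameInvariants1 γ W V :=
  ⟨h.1.symm, h.2.symm⟩

/-- The invariants of the first family persist in limits. -/
theorem SameInvariants1.of_tendsto {γ : ℝ} {l : Filter ℝ} [l.NeBot] {V : ℝ → State} {W X : State}
    (hW : W.IsPhysical) (hV : Tendsto V l (𝓝 W)) (h : ∀ᶠ ξ in l, SameInvariants1 γ X (V ξ)) :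
    SameInvariants1 γ X W := by
  have c1 : ContinuousAt (fun Y : State => Y.vel + 2 * Y.sound γ / (γ - 1)) W :=
    continuous_vel.continuousAt.add ((continuousAt_const.mul (continuousAt_sound γ hW)).div_const _)
  have c2 : ContinuousAt (fun Y : State => Y.pres / Y.rho ^ γ) W :=
    continuous_pres.continuousAt.div
      (continuous_rho.continuousAt.rpow_const (Or.inl hW.1.ne')) (Real.rpow_pos_of_pos hW.1 γ).ne'
  exact ⟨tendsto_nhds_unique (c1.tendsto.comp hV)
      (tendsto_const_nhds.congr' (h.mono fun ξ hξ => hξ.1.symm)),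
    tendsto_nhds_unique (c2.tendsto.comp hV)
      (tendsto_const_nhds.congr' (h.mono fun ξ hξ => hξ.2.symm))⟩

/-! ### Decomposition of a profile into finitely many pieces -/

/-- The admissible transitions of a profile `V` across the point `s`. -/
def IsJump (γ : ℝ) (V : ℝ → State) (L R : State) (s : ℝ) : Prop :=
  (L = R ∧ V s = L) ∨ IsShock1 γ L R s ∨ IsContact γ L R s ∨ IsShock3 γ L R s

/-- The profile `ξ = x / t ↦ U` of a self-similar, piecewise smooth entropy solution on the right
half plane, with value `Z` at infinity. -/
structure IsProfile (γ : ℝ) (V : ℝ → State) (D : Finset ℝ) (Z : State) : Prop where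
  physical : ∀ ξ > 0, (V ξ).IsPhysical
  contDiffOn : ContDiffOn ℝ 1 V (Ioi 0 \ D)
  ode : ∀ ξ > 0, ξ ∉ D → SimilarityODE γ V ξ
  jump : ∀ s ∈ D, 0 < s → ∃ L R : State, L.IsPhysical ∧ R.IsPhysical ∧
    Tendsto V (𝓝[<] s) (𝓝 L) ∧ Tendsto V (𝓝[>] s) (𝓝 R) ∧ IsJump γ V L R s
  physical_infty : Z.IsPhysical
  tendsto : Tendsto V atTop (𝓝 Z)

/-- `V` has the limit `W` at `b+`, and consists on `(b, ∞)` of finitely many constant states and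
centered fans separated by admissible transitions, the last state being `Z`. -/
inductive Tail (γ : ℝ) (V : ℝ → State) (Z : State) : ℝ → State → Prop
  | const {b : ℝ} (h : ∀ ξ > b, V ξ = Z) : Tail γ V Z b Z
  | constStep {b c : ℝ} {W R : State} (hbc : b < c) (hW : W.IsPhysical) (hR : R.IsPhysical)
      (h : ∀ ξ ∈ Ioo b c, V ξ = W) (hj : IsJump γ V W R c) (ht : Tail γ V Z c R) : Tail γ V Z b W
  | fan1Step {b c : ℝ} {W L R : State} (hbc : b < c) (hW : W.IsPhysical) (hL : L.IsPhysical)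
      (hR : R.IsPhysical) (hWb : W.char1 γ = b) (hLc : L.char1 γ = c)
      (h : ∀ ξ ∈ Ioo b c, (V ξ).IsPhysical ∧ SameInvariants1 γ W (V ξ) ∧ (V ξ).char1 γ = ξ)
      (hWL : SameInvariants1 γ W L) (hj : IsJump γ V L R c) (ht : Tail γ V Z c R) : Tail γ V Z b W
  | fan3Step {b c : ℝ} {W L R : State} (hbc : b < c) (hW : W.IsPhysical) (hL : L.IsPhysical)
      (hR : R.IsPhysical) (hWb : W.char3 γ = b) (hLc : L.char3 γ = c)
      (hvel : W.vel < L.vel) (hpres : W.pres < L.pres)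
      (hj : IsJump γ V L R c) (ht : Tail γ V Z c R) : Tail γ V Z b W

theorem eq_of_tendsto_of_eq_on {V : ℝ → State} {l : Filter ℝ} [l.NeBot] {f : State → ℝ}
    {W : State} {k : ℝ} (hf : ContinuousAt f W) (hV : Tendsto V l (𝓝 W)) (hl : l ≤ 𝓝 k)
    (h : ∀ᶠ ξ in l, f (V ξ) = ξ) : f W = k :=
  tendsto_nhds_unique ((hf.tendsto.comp hV).congr' h) hl

theorem lt_of_tendsto_of_strictMonoOn {V : ℝ → State} {b c : ℝ} (hbc : b < c) {f : State → ℝ}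
    (hf : Continuous f) {W L : State} (hW : Tendsto V (𝓝[>] b) (𝓝 W))
    (hL : Tendsto V (𝓝[<] c) (𝓝 L)) (h : ∀ ξ ∈ Ioo b c, ∀ η ∈ Ioo b c, ξ < η → f (V ξ) < f (V η)) :
    f W < f L := by
  obtain ⟨x, hx1, hx2⟩ := exists_between hbc
  obtain ⟨y, hy1, hy2⟩ := exists_between hx2
  have h1 : f W ≤ f (V x) := by
    refine le_of_tendsto ((hf.tendsto W).comp hW) ?_
    filter_upwards [Ioo_mem_nhdsGT hx1] with ξ hξ
    exact (h ξ ⟨hξ.1, hξ.2.trans hx2⟩ x ⟨hx1, hx2⟩ hξ.2).le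
  have h2 : f (V y) ≤ f L := by
    refine ge_of_tendsto ((hf.tendsto L).comp hL) ?_
    filter_upwards [Ioo_mem_nhdsLT hy2] with ξ hξ
    exact (h y ⟨hx1.trans hy1, hy2⟩ ξ ⟨(hx1.trans hy1).trans hξ.1, hξ.2⟩ hξ.1).le
  exact (h1.trans_lt (h x ⟨hx1, hx2⟩ y ⟨hx1.trans hy1, hy2⟩ hy1)).trans_le h2

theorem not_tendsto_of_eq_id {V : ℝ → State} {f : State → ℝ} {Z : State} {b : ℝ}
    (hf : ContinuousAt f Z) (hV : Tendsto V atTop (𝓝 Z)) (h : ∀ ξ > b, f (V ξ) = ξ) : False := by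
  have h1 : Tendsto (fun ξ : ℝ => ξ) atTop (𝓝 (f Z)) :=
    (hf.tendsto.comp hV).congr' ((eventually_gt_atTop b).mono h)
  exact not_tendsto_nhds_of_tendsto_atTop tendsto_id _ h1

/-- Induction on the number of breakpoints beyond `b`, splitting at the smallest one. The last,
unbounded piece cannot be a fan: a characteristic speed equal to `ξ` would be unbounded, whereas `V`
converges at infinity. -/
theorem IsProfile.tail {γ : ℝ} (hγ : 1 < γ) {V : ℝ → State} {D : Finset ℝ} {Z : State}
    (hV : IsProfile γ V D Z) {b : ℝ} (hb : 0 ≤ b) {W : State} (hW : W.IsPhysical)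
    (hbW : Tendsto V (𝓝[>] b) (𝓝 W)) : Tail γ V Z b W := by
  induction hn : (D.filter (b < ·)).card using Nat.strong_induction_on generalizing b W with
  | _ n ih =>
  subst hn
  have smooth : ∀ S : Set ℝ, IsOpen S → Convex ℝ S → (∀ ξ ∈ S, 0 < ξ ∧ ξ ∉ D) → _ :=
    fun S hS hc h => SimilarityODE.const_or_fan hγ hS hc (fun ξ hξ => hV.physical ξ (h ξ hξ).1)
      (hV.contDiffOn.mono fun ξ hξ => ⟨(h ξ hξ).1, (h ξ hξ).2⟩)
      (fun ξ hξ => hV.ode ξ (h ξ hξ).1 (h ξ hξ).2)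
  rcases (D.filter (b < ·)).eq_empty_or_nonempty with he | hne
  · have hD : ∀ ξ ∈ Ioi b, 0 < ξ ∧ ξ ∉ D := fun ξ hξ =>
      ⟨hb.trans_lt hξ, fun hm => by
        have : ξ ∈ D.filter (b < ·) := Finset.mem_filter.2 ⟨hm, hξ⟩
        simp [he] at this⟩
    rcases smooth (Ioi b) isOpen_Ioi (convex_Ioi b) hD with ⟨X, hX⟩ | ⟨h, -⟩ | ⟨h, -⟩
    · have h1 : W = X := tendsto_nhds_unique hbW (tendsto_const_nhds.congr'
        (eventually_nhdsWithin_of_forall fun ξ hξ => (hX ξ hξ).symm))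
      have h2 : Z = X := tendsto_nhds_unique hV.tendsto (tendsto_const_nhds.congr'
        ((eventually_gt_atTop b).mono fun ξ hξ => (hX ξ hξ).symm))
      rw [h1, ← h2]
      exact .const fun ξ hξ => (hX ξ hξ).trans h2.symm
    · exact (not_tendsto_of_eq_id (continuousAt_char1 γ hV.physical_infty) hV.tendsto h).elim
    · exact (not_tendsto_of_eq_id (continuousAt_char3 γ hV.physical_infty) hV.tendsto h).elim
  · obtain ⟨c, hcm, hmin⟩ : ∃ c ∈ D.filter (b < ·), ∀ ξ ∈ D.filter (b < ·), c ≤ ξ :=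
      ⟨_, Finset.min'_mem _ hne, fun ξ hξ => Finset.min'_le _ ξ hξ⟩
    obtain ⟨hcD, hbc⟩ := Finset.mem_filter.1 hcm
    have hD : ∀ ξ ∈ Ioo b c, 0 < ξ ∧ ξ ∉ D := fun ξ hξ =>
      ⟨hb.trans_lt hξ.1, fun hm => (hmin ξ (Finset.mem_filter.2 ⟨hm, hξ.1⟩)).not_gt hξ.2⟩
    obtain ⟨L, R, hL, hR, tL, tR, hj⟩ := hV.jump c hcD (hb.trans_lt hbc)
    have ht : Tail γ V Z c R := by
      refine ih _ (Finset.card_lt_card ?_) (hb.trans hbc.le) hR tR rfl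
      refine (Finset.ssubset_iff_of_subset fun ξ hξ => ?_).2 ⟨c, hcm, by simp⟩
      rw [Finset.mem_filter] at hξ ⊢
      exact ⟨hξ.1, hbc.trans hξ.2⟩
    have eb : ∀ᶠ ξ in 𝓝[>] b, ξ ∈ Ioo b c := Ioo_mem_nhdsGT hbc
    have ec : ∀ᶠ ξ in 𝓝[<] c, ξ ∈ Ioo b c := Ioo_mem_nhdsLT hbc
    rcases smooth (Ioo b c) isOpen_Ioo (convex_Ioo b c) hD with ⟨X, hX⟩ | ⟨h, h'⟩ | ⟨h, h'⟩
    · have h1 : W = X := tendsto_nhds_unique hbW (tendsto_const_nhds.congr'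
        (eb.mono fun ξ hξ => (hX ξ hξ).symm))
      have h2 : L = X := tendsto_nhds_unique tL (tendsto_const_nhds.congr'
        (ec.mono fun ξ hξ => (hX ξ hξ).symm))
      subst h1 h2
      exact .constStep hbc hW hR hX hj ht
    · have inv : ∀ ξ ∈ Ioo b c, SameInvariants1 γ W (V ξ) := fun ξ hξ =>
        (SameInvariants1.of_tendsto hW hbW (eb.mono fun η hη => h' ξ hξ η hη)).symm
      exact .fan1Step hbc hW hL hR
        (eq_of_tendsto_of_eq_on (continuousAt_char1 γ hW) hbW nhdsWithin_le_nhds (eb.mono h))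
        (eq_of_tendsto_of_eq_on (continuousAt_char1 γ hL) tL nhdsWithin_le_nhds (ec.mono h))
        (fun ξ hξ => ⟨hV.physical ξ (hD ξ hξ).1, inv ξ hξ, h ξ hξ⟩)
        (SameInvariants1.of_tendsto hL tL (ec.mono inv)) hj ht
    · exact .fan3Step hbc hW hL hR
        (eq_of_tendsto_of_eq_on (continuousAt_char3 γ hW) hbW nhdsWithin_le_nhds (eb.mono h))
        (eq_of_tendsto_of_eq_on (continuousAt_char3 γ hL) tL nhdsWithin_le_nhds (ec.mono h))
        (lt_of_tendsto_of_strictMonoOn hbc continuous_vel hbW tL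
          fun ξ hξ η hη hlt => (h' ξ hξ η hη hlt).1)
        (lt_of_tendsto_of_strictMonoOn hbc continuous_pres hbW tL
          fun ξ hξ η hη hlt => (h' ξ hξ η hη hlt).2) hj ht

/-! ### The ordering of the waves -/

/-- On `(b, ∞)` at most a wave of the third family, joining `W` to `Z`. -/
def Wave3 (γ : ℝ) (V : ℝ → State) (Z : State) (b : ℝ) (W : State) : Prop :=
  (W = Z ∧ ∀ ξ > b, V ξ = Z) ∨
  (∃ s, b < s ∧ IsShock3 γ W Z s ∧ (∀ ξ ∈ Ioo b s, V ξ = W) ∧ ∀ ξ > s, V ξ = Z) ∨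
  (b ≤ W.char3 γ ∧ W.vel < Z.vel ∧ W.pres < Z.pres)

/-- On `(b, ∞)` at most a contact discontinuity and a wave of the third family. -/
def Wave23 (γ : ℝ) (V : ℝ → State) (Z : State) (b : ℝ) (W : State) : Prop :=
  Wave3 γ V Z b W ∨
  ∃ (X : State) (s : ℝ), b < s ∧ X.IsPhysical ∧ IsContact γ W X s ∧ (∀ ξ ∈ Ioo b s, V ξ = W) ∧
    Wave3 γ V Z s X

/-- On `(b, ∞)` at most one wave of each family. -/
def Wave123 (γ : ℝ) (V : ℝ → State) (Z : State) (b : ℝ) (W : State) : Prop :=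
  Wave23 γ V Z b W ∨
  (∃ (X : State) (s : ℝ), b < s ∧ X.IsPhysical ∧ IsShock1 γ W X s ∧ Wave23 γ V Z s X) ∨
  ∃ X : State, X.IsPhysical ∧ b ≤ W.char1 γ ∧ W.char1 γ < X.char1 γ ∧ SameInvariants1 γ W X ∧
    (∀ ξ ∈ Ioo b (W.char1 γ), V ξ = W) ∧
    (∀ ξ > b, W.char1 γ ≤ ξ → ξ ≤ X.char1 γ →
      (V ξ).IsPhysical ∧ SameInvariants1 γ W (V ξ) ∧ (V ξ).char1 γ = ξ) ∧
    Wave23 γ V Z (X.char1 γ) X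

theorem forall_Ioo_glue {V : ℝ → State} {b c s : ℝ} {W : State}
    (h : ∀ ξ ∈ Ioo b c, V ξ = W) (hc : V c = W) (h' : ∀ ξ ∈ Ioo c s, V ξ = W) :
    ∀ ξ ∈ Ioo b s, V ξ = W := fun ξ hξ => by
  rcases lt_trichotomy ξ c with h1 | rfl | h1
  · exact h ξ ⟨hξ.1, h1⟩
  · exact hc
  · exact h' ξ ⟨h1, hξ.2⟩

theorem Wave3.extend {γ : ℝ} {V : ℝ → State} {Z : State} {b c : ℝ} {W : State} (hbc : b < c)
    (h : ∀ ξ ∈ Ioo b c, V ξ = W) (hc : V c = W) (hw : Wave3 γ V Z c W) : Wave3 γ V Z b W := by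
  rcases hw with ⟨rfl, h1⟩ | ⟨s, hs, h1, h2, h3⟩ | ⟨h1, h2⟩
  · refine Or.inl ⟨rfl, fun ξ hξ => ?_⟩
    rcases lt_trichotomy ξ c with h2 | rfl | h2
    · exact h ξ ⟨hξ, h2⟩
    · exact hc
    · exact h1 ξ h2
  · exact Or.inr (Or.inl ⟨s, hbc.trans hs, h1, forall_Ioo_glue h hc h2, h3⟩)
  · exact Or.inr (Or.inr ⟨hbc.le.trans h1, h2⟩)

theorem Wave23.extend {γ : ℝ} {V : ℝ → State} {Z : State} {b c : ℝ} {W : State} (hbc : b < c)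
    (h : ∀ ξ ∈ Ioo b c, V ξ = W) (hc : V c = W) (hw : Wave23 γ V Z c W) : Wave23 γ V Z b W := by
  rcases hw with h1 | ⟨X, s, hs, hX, h1, h2, h3⟩
  · exact Or.inl (h1.extend hbc h hc)
  · exact Or.inr ⟨X, s, hbc.trans hs, hX, h1, forall_Ioo_glue h hc h2, h3⟩

/-- Behind a shock of the third family there is no further wave. -/
theorem Wave3.of_shock3 {γ : ℝ} {V : ℝ → State} {Z : State} {b c : ℝ} {W R : State} (hbc : b < c)
    (h : ∀ ξ ∈ Ioo b c, V ξ = W) (hs : IsShock3 γ W R c) (hw : Wave3 γ V Z c R) :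
    Wave3 γ V Z b W := by
  have h3 := hs.2.2.2
  rcases hw with ⟨rfl, h1⟩ | ⟨s, h4, h1, -⟩ | ⟨h1, -⟩
  · exact Or.inr (Or.inl ⟨c, hbc, hs, h, h1⟩)
  · linarith [h1.2.2.1]
  · linarith

/-- Beyond the particle speed, contacts and 1-waves are too slow to occur. After a 3-shock or a
3-fan the Lax inequalities exclude a further 3-shock, while consecutive fans merge. -/
theorem Tail.wave3 {γ : ℝ} (hγ : 1 < γ) {V : ℝ → State} {Z : State} {b : ℝ} {W : State}
    (h : Tail γ V Z b W) (hb : W.vel ≤ b) : Wave3 γ V Z b W := by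
  induction h with
  | const h => exact Or.inl ⟨rfl, h⟩
  | @constStep b c W R hbc hW hR h hj ht ih =>
    have aW := sound_pos hγ hW
    have aR := sound_pos hγ hR
    rcases hj with ⟨rfl, hc⟩ | hs | hs | hs
    · exact (ih (hb.trans hbc.le)).extend hbc h hc
    · have := hs.2.1
      simp only [char1] at this
      linarith
    · linarith [hs.2.1]
    · have h3 := hs.2.2.2
      simp only [char3] at h3
      exact .of_shock3 hbc h hs (ih (by linarith))
  | @fan1Step b c W L R hbc hW hL hR hWb hLc h hWL hj ht ih =>
    have aW := sound_pos hγ hW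
    simp only [char1] at hWb
    linarith
  | @fan3Step b c W L R hbc hW hL hR hWb hLc hvel hpres hj ht ih =>
    have aL := sound_pos hγ hL
    simp only [char3] at hLc
    rcases hj with ⟨rfl, hc⟩ | hs | hs | hs
    · refine Or.inr (Or.inr ⟨hWb.ge, ?_⟩)
      rcases ih (by linarith) with ⟨rfl, -⟩ | ⟨s, h1, h2, -⟩ | ⟨-, h1, h2⟩
      · exact ⟨hvel, hpres⟩
      · have := h2.2.2.1
        simp only [char3] at this
        linarith
      · exact ⟨hvel.trans h1, hpres.trans h2⟩
    · have := hs.2.1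
      simp only [char1] at this
      linarith
    · linarith [hs.2.1]
    · have := hs.2.2.1
      simp only [char3] at this
      linarith

/-- Beyond the speed `u - a` no 1-wave fits; after a contact or a 3-wave, `Tail.wave3` applies. -/
theorem Tail.wave23 {γ : ℝ} (hγ : 1 < γ) {V : ℝ → State} {Z : State} {b : ℝ} {W : State}
    (h : Tail γ V Z b W) (hb : W.char1 γ < b) : Wave23 γ V Z b W := by
  induction h with
  | const h => exact Or.inl (Or.inl ⟨rfl, h⟩)
  | @constStep b c W R hbc hW hR h hj ht ih =>
    have aR := sound_pos hγ hR
    rcases hj with ⟨rfl, hc⟩ | hs | hs | hs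
    · exact (ih (hb.trans hbc)).extend hbc h hc
    · linarith [hs.2.1]
    · exact Or.inr ⟨R, c, hbc, hR, hs, h, ht.wave3 hγ hs.2.2.1.le⟩
    · have h3 := hs.2.2.2
      simp only [char3] at h3
      exact Or.inl (.of_shock3 hbc h hs (ht.wave3 hγ (by linarith)))
  | @fan1Step b c W L R hbc hW hL hR hWb hLc h hWL hj ht ih => exact absurd hWb hb.ne
  | @fan3Step b c W L R hbc hW hL hR hWb hLc hvel hpres hj ht ih =>
    have aW := sound_pos hγ hW
    refine Or.inl (Tail.wave3 hγ (.fan3Step hbc hW hL hR hWb hLc hvel hpres hj ht) ?_)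
    simp only [char3] at hWb
    linarith

theorem Tail.wave123 {γ : ℝ} (hγ : 1 < γ) {V : ℝ → State} {Z : State} {b : ℝ} {W : State}
    (h : Tail γ V Z b W) : Wave123 γ V Z b W := by
  induction h with
  | const h => exact Or.inl (Or.inl (Or.inl ⟨rfl, h⟩))
  | @constStep b c W R hbc hW hR h hj ht ih =>
    have aR := sound_pos hγ hR
    rcases hj with ⟨rfl, hc⟩ | hs | hs | hs
    · rcases ih with h1 | ⟨X, s, h1, h2⟩ | ⟨X, hX, h1, h2, h3, h4, h5, h6⟩
      · exact Or.inl (h1.extend hbc h hc)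
      · exact Or.inr (Or.inl ⟨X, s, hbc.trans h1, h2⟩)
      · refine Or.inr (Or.inr ⟨X, hX, hbc.le.trans h1, h2, h3, forall_Ioo_glue h hc h4, ?_, h6⟩)
        intro ξ hξ h7 h8
        rcases eq_or_lt_of_le (h1.trans h7) with h9 | h9
        · subst h9
          rw [hc]
          exact ⟨hW, ⟨rfl, rfl⟩, le_antisymm h7 h1⟩
        · exact h5 ξ h9 h7 h8
    · exact Or.inr (Or.inl ⟨R, c, hbc, hR, hs, ht.wave23 hγ hs.2.2.1⟩)
    · exact Or.inl (Or.inr ⟨R, c, hbc, hR, hs, h, ht.wave3 hγ hs.2.2.1.le⟩)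
    · have h3 := hs.2.2.2
      simp only [char3] at h3
      exact Or.inl (Or.inl (.of_shock3 hbc h hs (ht.wave3 hγ (by linarith))))
  | @fan1Step b c W L R hbc hW hL hR hWb hLc h hWL hj ht ih =>
    have aL := sound_pos hγ hL
    have hvel : c < L.vel := by simp only [char1] at hLc; linarith
    refine Or.inr (Or.inr ?_)
    have edge : ∀ ξ ∈ Ioo b (W.char1 γ), V ξ = W := fun ξ hξ => by
      rw [hWb] at hξ
      exact absurd hξ.1 hξ.2.not_gt
    rcases hj with ⟨rfl, hc⟩ | hs | hs | hs
    · have fan : ∀ ξ > b, ξ ≤ c →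
          (V ξ).IsPhysical ∧ SameInvariants1 γ W (V ξ) ∧ (V ξ).char1 γ = ξ := fun ξ h1 h2 => by
        rcases eq_or_lt_of_le h2 with rfl | h2
        · rw [hc]
          exact ⟨hL, hWL, hLc⟩
        · exact h ξ ⟨h1, h2⟩
      -- A breakpoint with a continuous transition may lie inside a single fan; its two parts are
      -- joined here. A 1-shock behind the fan would have to be slower than the fan's edge.
      rcases ih with h1 | ⟨X, s, h1, h2, h3, -⟩ | ⟨X, hX, h1, h2, h3, h4, h5, h6⟩
      · refine ⟨L, hL, hWb.ge, by rwa [hWb, hLc], hWL, edge, fun ξ h2 _ h3 => ?_, ?_⟩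
        · exact fan ξ h2 (h3.trans hLc.le)
        · rwa [hLc]
      · linarith [h3.2.1]
      · refine ⟨X, hX, hWb.ge, by linarith, hWL.trans h3, edge, fun ξ h7 _ h8 => ?_, h6⟩
        rcases le_or_gt ξ c with h9 | h9
        · exact fan ξ h7 h9
        · obtain ⟨k1, k2, k3⟩ := h5 ξ h9 (hLc.le.trans h9.le) h8
          exact ⟨k1, hWL.trans k2, k3⟩
    · linarith [hs.2.1]
    · linarith [hs.2.1]
    · linarith [hs.2.1]
  | @fan3Step b c W L R hbc hW hL hR hWb hLc hvel hpres hj ht ih =>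
    have aW := sound_pos hγ hW
    refine Or.inl (Tail.wave23 hγ (.fan3Step hbc hW hL hR hWb hLc hvel hpres hj ht) ?_)
    simp only [char3] at hWb
    simp only [char1]
    linarith

/-! ### Profiles of solutions -/

theorem HasDerivAt.cons {γ : ℝ} {V : ℝ → State} {d : State} {ξ : ℝ} (h : HasDerivAt V d ξ) :
    HasDerivAt (fun η => (V η).cons γ)
      (d.rho, d.rho * (V ξ).vel + (V ξ).rho * d.vel,
        d.pres / (γ - 1) + (d.rho * (V ξ).vel ^ 2 + (V ξ).rho * (2 * (V ξ).vel * d.vel)) / 2) ξ := by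
  have h1 := h.rho
  have h2 := h.vel
  have h3 := h.pres
  have h4 := h2.pow 2
  simp only [Nat.cast_ofNat, Nat.add_one_sub_one, pow_one] at h4
  exact h1.prodMk ((h1.mul h2).prodMk ((h3.div_const _).add ((h1.mul h4).div_const 2)))

theorem HasDerivAt.flux {γ : ℝ} {V : ℝ → State} {d : State} {ξ : ℝ} (h : HasDerivAt V d ξ) :
    HasDerivAt (fun η => (V η).flux γ)
      (d.rho * (V ξ).vel + (V ξ).rho * d.vel,
        d.rho * (V ξ).vel ^ 2 + (V ξ).rho * (2 * (V ξ).vel * d.vel) + d.pres,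
        (d.pres / (γ - 1) + (d.rho * (V ξ).vel ^ 2 + (V ξ).rho * (2 * (V ξ).vel * d.vel)) / 2
          + d.pres) * (V ξ).vel + ((V ξ).energy γ + (V ξ).pres) * d.vel) ξ := by
  have h1 := h.rho
  have h2 := h.vel
  have h3 := h.pres
  have h4 := h2.pow 2
  simp only [Nat.cast_ofNat, Nat.add_one_sub_one, pow_one] at h4
  exact (h1.mul h2).prodMk (((h1.mul h4).add h3).prodMk
    ((((h3.div_const _).add ((h1.mul h4).div_const 2)).add h3).mul h2))

/-- By self-similarity the time derivative at `t = 1` is `-ξ` times the derivative of the profile;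
the conservative equations then reduce to primitive form. -/
theorem SimilarityODE.of_pde {γ : ℝ} (hγ : 1 < γ) {U : ℝ → ℝ → State} {ξ : ℝ}
    (hd : DifferentiableAt ℝ (fun y => U y 1) ξ) (hs : ∀ t > 0, U ξ t = U (ξ / t) 1)
    (hpde : deriv (fun τ => (U ξ τ).cons γ) 1 + deriv (fun y => (U y 1).flux γ) ξ = 0) :
    SimilarityODE γ (fun y => U y 1) ξ := by
  have hd := hd.hasDerivAt
  generalize deriv (fun y => U y 1) ξ = d at hd
  have hξ : HasDerivAt (fun τ : ℝ => ξ / τ) (-ξ) 1 := by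
    simpa [div_eq_mul_inv] using (hasDerivAt_inv (one_ne_zero (α := ℝ))).const_mul ξ
  have ht : HasDerivAt (fun τ => U ξ τ) (-ξ • d) 1 := by
    have h1 : HasDerivAt (fun y => U y 1) d (ξ / 1) := by rwa [div_one]
    exact (h1.scomp 1 hξ).congr_of_eventuallyEq ((eventually_gt_nhds one_pos).mono hs)
  rw [(HasDerivAt.cons ht).deriv, (HasDerivAt.flux hd).deriv] at hpde
  refine ⟨d, hd, ?_⟩
  simp only [State.rho, State.vel, State.pres, energy, Prod.smul_fst, Prod.smul_snd, smul_eq_mul,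
    Prod.mk_add_mk, Prod.mk_eq_zero] at hpde ⊢
  obtain ⟨e1, e2, e3⟩ := hpde
  have hg : γ - 1 ≠ 0 := by linarith
  generalize (U ξ 1).2.1 = u at *
  generalize (U ξ 1).1 = r at *
  generalize (U ξ 1).2.2 = p at *
  have e1' : (u - ξ) * d.1 + r * d.2.1 = 0 := by linear_combination e1
  have e2' : r * ((u - ξ) * d.2.1) + d.2.2 = 0 := by linear_combination e2 - u * e1
  refine ⟨e1', e2', ?_⟩
  field_simp at e3
  linear_combination (1 / 2) * e3 - (γ - 1) * u * e2' - (γ - 1) / 2 * u ^ 2 * e1'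

theorem SolvesEulerOn.eq_profile {γ : ℝ} {Ω : Set ℝ} {U : ℝ → ℝ → State}
    (h : SolvesEulerOn γ Ω U) {x t : ℝ} (hx : x ∈ Ω) (ht : 0 < t) : U x t = U (x / t) 1 := by
  rw [← h.selfSimilar x hx t ht t⁻¹ (inv_pos.2 ht), inv_mul_cancel₀ ht.ne', inv_mul_eq_div]

theorem SolvesEulerOn.profile {γ : ℝ} (hγ : 1 < γ) {Ω : Set ℝ} (hΩ : IsOpen Ω)
    {U : ℝ → ℝ → State} (h : SolvesEulerOn γ Ω U) :
    ∃ D : Finset ℝ, ContDiffOn ℝ 1 (fun ξ => U ξ 1) (Ω \ D) ∧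
      (∀ ξ ∈ Ω, ξ ∉ D → SimilarityODE γ (fun ξ => U ξ 1) ξ) ∧
      ∀ s ∈ D, s ∈ Ω → ∃ L R : State, L.IsPhysical ∧ R.IsPhysical ∧
        Tendsto (fun ξ => U ξ 1) (𝓝[<] s) (𝓝 L) ∧ Tendsto (fun ξ => U ξ 1) (𝓝[>] s) (𝓝 R) ∧
        IsJump γ (fun ξ => U ξ 1) L R s := by
  obtain ⟨D, h1, h2, h3⟩ := h.piecewise
  have hc : ContDiffOn ℝ 1 (fun ξ => U ξ 1) (Ω \ D) := by
    refine h1.comp (f := fun ξ : ℝ => (ξ, (1 : ℝ))) (by fun_prop) ?_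
    intro ξ hξ
    exact ⟨hξ.1, one_pos, by simpa using hξ.2⟩
  have ho : IsOpen (Ω \ (D : Set ℝ)) := hΩ.sdiff D.finite_toSet.isClosed
  refine ⟨D, hc, fun ξ hξ hD => ?_, fun s hs hsΩ => ?_⟩
  · refine .of_pde hγ ?_ (fun t ht => h.eq_profile hξ ht) (h2 ξ hξ 1 one_pos (by simpa using hD))
    exact (hc.differentiableOn one_ne_zero).differentiableAt (ho.mem_nhds ⟨hξ, hD⟩)
  · obtain ⟨L, R, hL, hR, tL, tR, hj⟩ := h3 s hs hsΩ
    refine ⟨L, R, hL, hR, by simpa using tL 1 one_pos, by simpa using tR 1 one_pos, ?_⟩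
    exact hj.imp_left fun hj => ⟨hj.1, by simpa using hj.2 1 one_pos⟩

/-- The initial condition at `x = 1` becomes the limit at infinity, through `ξ = 1 / t`. -/
theorem SolvesEulerOn.isProfile {γ : ℝ} (hγ : 1 < γ) {U : ℝ → ℝ → State} {Z : State}
    (h : SolvesEulerOn γ (Ioi 0) U) (hZ : Z.IsPhysical)
    (hi : Tendsto (fun t => U 1 t) (𝓝[>] 0) (𝓝 Z)) : ∃ D, IsProfile γ (fun ξ => U ξ 1) D Z := by
  obtain ⟨D, h1, h2, h3⟩ := h.profile hγ isOpen_Ioi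
  refine ⟨D, fun ξ hξ => h.physical ξ hξ 1 one_pos, h1, h2, h3, hZ, ?_⟩
  refine (hi.comp tendsto_inv_atTop_nhdsGT_zero).congr' ?_
  filter_upwards [eventually_gt_atTop 0] with ξ hξ
  simp only [Function.comp_apply]
  rw [h.eq_profile (mem_Ioi.2 one_pos) (inv_pos.2 hξ), one_div, inv_inv]

theorem SimilarityODE.reflect {γ : ℝ} {V : ℝ → State} {ξ : ℝ} (h : SimilarityODE γ V (-ξ)) :
    SimilarityODE γ (fun η => (V (-η)).reflect) ξ := by
  obtain ⟨d, hd, e1, e2, e3⟩ := h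
  have h1 : HasDerivAt (fun η => V (-η)) (-d) ξ := by
    have := hd.scomp ξ (hasDerivAt_neg ξ)
    rwa [neg_one_smul] at this
  refine ⟨(-d).reflect, h1.rho.prodMk (h1.vel.neg.prodMk h1.pres), ?_⟩
  simp only [rho_reflect, vel_reflect, pres_reflect]
  have n1 : (-d).rho = -d.rho := rfl
  have n2 : (-d).vel = -d.vel := rfl
  have n3 : (-d).pres = -d.pres := rfl
  rw [n1, n2, n3]
  exact ⟨by linear_combination e1, by linear_combination -e2, by linear_combination e3⟩

theorem SolvesEulerOn.isProfile_reflect {γ : ℝ} (hγ : 1 < γ) {U : ℝ → ℝ → State} {Z : State}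
    (h : SolvesEulerOn γ (Iio 0) U) (hZ : Z.IsPhysical)
    (hi : Tendsto (fun t => U (-1) t) (𝓝[>] 0) (𝓝 Z)) :
    ∃ D, IsProfile γ (fun ξ => (U (-ξ) 1).reflect) D Z.reflect := by
  obtain ⟨D, h1, h2, h3⟩ := h.profile hγ isOpen_Iio
  have hD : ∀ ξ, ξ ∈ D.image Neg.neg ↔ -ξ ∈ D := fun ξ => by
    simp [Finset.mem_image, neg_eq_iff_eq_neg]
  refine ⟨D.image Neg.neg, fun ξ hξ => h.physical (-ξ) (by simpa using hξ) 1 one_pos, ?_,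
    fun ξ hξ hξD => (h2 (-ξ) (by simpa using hξ) (by rwa [← hD])).reflect,
    fun s hs hs0 => ?_, hZ, ?_⟩
  · have h4 : ContDiffOn ℝ 1 (fun ξ => U (-ξ) 1) (Ioi 0 \ (D.image Neg.neg : Finset ℝ)) := by
      refine h1.comp (f := fun ξ : ℝ => -ξ) (by fun_prop) fun ξ hξ => ?_
      exact ⟨by simpa using hξ.1, fun hm => hξ.2 (Finset.mem_coe.2 ((hD ξ).2 hm))⟩
    exact h4.fst.prodMk (h4.snd.fst.neg.prodMk h4.snd.snd)
  · obtain ⟨L, R, hL, hR, tL, tR, hj⟩ := h3 (-s) ((hD s).1 hs) (by simpa using hs0)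
    refine ⟨R.reflect, L.reflect, hR, hL, ?_, ?_, ?_⟩
    · exact (continuous_reflect.tendsto R).comp (tR.comp tendsto_neg_nhdsLT)
    · exact (continuous_reflect.tendsto L).comp (tL.comp tendsto_neg_nhdsGT)
    · rcases hj with ⟨rfl, hc⟩ | hs | hs | hs
      · exact Or.inl ⟨rfl, congrArg State.reflect hc⟩
      · exact Or.inr (Or.inr (Or.inr (by simpa using hs.reflect)))
      · exact Or.inr (Or.inr (Or.inl (by simpa using hs.reflect)))
      · exact Or.inr (Or.inl (by simpa using hs.reflect))
  · refine (continuous_reflect.tendsto Z).comp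
      ((hi.comp tendsto_inv_atTop_nhdsGT_zero).congr' ?_)
    filter_upwards [eventually_gt_atTop 0] with ξ hξ
    simp only [Function.comp_apply]
    rw [h.eq_profile (mem_Iio.2 neg_one_lt_zero) (inv_pos.2 hξ), div_inv_eq_mul, neg_one_mul]

/-! ### The wave structures -/

/-- Across a 3-wave, shock or rarefaction, pressure and velocity move the same way. This is the only
information about 3-rarefactions used to exclude them. -/
theorem Wave3.sign {γ : ℝ} (hγ : 1 < γ) {V : ℝ → State} {Z : State} {b : ℝ} {W : State}
    (hW : W.IsPhysical) (hZ : Z.IsPhysical) (h : Wave3 γ V Z b W) :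
    (W.pres = Z.pres ∧ W.vel = Z.vel) ∨ (Z.pres < W.pres ∧ Z.vel < W.vel) ∨
      (W.pres < Z.pres ∧ W.vel < Z.vel) := by
  rcases h with ⟨rfl, -⟩ | ⟨s, -, h, -⟩ | ⟨-, h1, h2⟩
  · exact Or.inl ⟨rfl, rfl⟩
  · obtain ⟨h1, h2, -⟩ := h.relations hγ hW hZ
    exact Or.inr (Or.inl ⟨h1, h2⟩)
  · exact Or.inr (Or.inr ⟨h2, h1⟩)

theorem Wave23.sign {γ : ℝ} (hγ : 1 < γ) {V : ℝ → State} {Z : State} {b : ℝ} {W : State}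
    (hW : W.IsPhysical) (hZ : Z.IsPhysical) (h : Wave23 γ V Z b W) :
    (W.pres = Z.pres ∧ W.vel = Z.vel) ∨ (Z.pres < W.pres ∧ Z.vel < W.vel) ∨
      (W.pres < Z.pres ∧ W.vel < Z.vel) := by
  rcases h with h | ⟨X, s, -, hX, h1, -, h2⟩
  · exact h.sign hγ hW hZ
  · rw [h1.pres_eq, h1.vel_eq]
    exact h2.sign hγ hX hZ

/-- `hnot` excludes a missing 3-wave and a 3-rarefaction, with or without a contact. `hH` excludes a
3-shock issuing directly from `W`, since `W` would then lie on the Hugoniot curve of `Z`. -/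
theorem Wave23.contact_shock {γ : ℝ} (hγ : 1 < γ) {V : ℝ → State} {Z : State} {b : ℝ} {W : State}
    (hW : W.IsPhysical) (hZ : Z.IsPhysical) (h : Wave23 γ V Z b W)
    (hnot : W.pres ≤ Z.pres → Z.vel < W.vel)
    (hH : Z.pres < W.pres → BelowHugoniot γ Z W) :
    ∃ (X : State) (s r : ℝ), X.IsPhysical ∧ b < s ∧ s < r ∧ IsContact γ W X s ∧
      IsShock3 γ X Z r ∧ (∀ ξ ∈ Ioo b s, V ξ = W) ∧ (∀ ξ ∈ Ioo s r, V ξ = X) ∧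
      ∀ ξ > r, V ξ = Z := by
  rcases h with (⟨rfl, -⟩ | ⟨s, -, h, -⟩ | ⟨-, h1, h2⟩) | ⟨X, s, hs, hX, h1, h2, h3⟩
  · exact absurd (hnot le_rfl) (lt_irrefl _)
  · exact absurd (hH (h.relations hγ hW hZ).1) (h.not_belowHugoniot hγ hW hZ)
  · exact absurd (hnot h2.le) h1.not_gt
  · rcases h3 with ⟨rfl, -⟩ | ⟨r, h3, h4, h5, h6⟩ | ⟨-, h4, h5⟩
    · exact absurd (hnot h1.pres_eq.le) (by rw [h1.vel_eq]; exact lt_irrefl _)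
    · exact ⟨X, s, r, hX, hs, h3, h1, h4, h2, h5, h6⟩
    · exact absurd (hnot (h1.pres_eq.le.trans h5.le)) (by rw [h1.vel_eq]; exact h4.not_gt)

/-- If `W` is not supersonic, a wave of the first family in `x > 0` starting from `W` is a
rarefaction that starts at `x = 0`. -/
theorem Wave123.of_char1_nonpos {γ : ℝ} (hγ : 1 < γ) {V : ℝ → State} {Z W : State}
    (hW : W.IsPhysical) (h : Wave123 γ V Z 0 W) (hc : W.char1 γ ≤ 0) :
    ∃ X : State, X.IsPhysical ∧ IsRarefaction1 γ W X ∧ X.pres ≤ W.pres ∧ W.vel ≤ X.vel ∧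
      W.pres - X.pres ≤ W.rho * W.sound γ * (X.vel - W.vel) ∧
      (X = W ∧ Wave23 γ V Z 0 X ∨ W.char1 γ = 0 ∧
        (∀ ξ > 0, W.char1 γ ≤ ξ → ξ ≤ X.char1 γ →
          (V ξ).IsPhysical ∧ SameInvariants1 γ W (V ξ) ∧ (V ξ).char1 γ = ξ) ∧
        Wave23 γ V Z (X.char1 γ) X) := by
  rcases h with h | ⟨X, s, h1, hX, h2, h3⟩ | ⟨X, hX, h1, h2, h3, h4, h5, h6⟩
  · exact ⟨W, hW, ⟨⟨rfl, rfl⟩, le_rfl⟩, le_rfl, le_rfl, by simp, Or.inl ⟨rfl, h⟩⟩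
  · linarith [h2.2.1]
  · have hr : IsRarefaction1 γ W X := ⟨h3, h2.le⟩
    obtain ⟨k1, k2, k3⟩ := hr.relations hγ hW hX h2
    exact ⟨X, hX, hr, k2.le, k1.le, k3.le, Or.inr ⟨le_antisymm hc h1, h5, h6⟩⟩

theorem BelowHugoniot.of_rarefaction1 {γ : ℝ} (hγ : 1 < γ) {V₁ V W : State} (hV₁ : V₁.IsPhysical)
    (hV : V.IsPhysical) (hW : W.IsPhysical) (h : BelowHugoniot γ V₁ V)
    (hp : W.pres ≤ V.pres) (hr : IsRarefaction1 γ V W) : BelowHugoniot γ V₁ W :=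
  h.of_isentropic hγ hV₁ hV hW hp hr.1.2

/-- A flow that enters the heating region with positive velocity and not supersonically cannot
come from `x < 0` undisturbed or through a rarefaction. -/
theorem exists_shock1_of_subsonic {γ Q : ℝ} (hγ : 1 < γ) (hQ : 0 < Q) {V V' : ℝ → State} {b : ℝ}
    {U₁ U₄ U₅ U₆ : State} (h₁ : U₁.IsPhysical) (h₄ : U₄.IsPhysical) (h₅ : U₅.IsPhysical)
    (h₆ : U₆.IsPhysical) (hu : 0 < U₄.vel) (hH : IsHeating γ Q U₄ U₅) (hp₅ : U₅.pres < U₄.pres)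
    (hu₅ : U₄.vel < U₅.vel) (hr : IsRarefaction1 γ U₅ U₆)
    (hp₆ : U₆.pres ≤ U₅.pres) (hu₆ : U₅.vel ≤ U₆.vel)
    (hpu : U₅.pres - U₆.pres ≤ U₅.rho * U₅.sound γ * (U₆.vel - U₅.vel))
    (hs : U₅.char1 γ = 0 ∨ U₆ = U₅)
    (hl : Wave3 γ V' U₁.reflect 0 U₄.reflect) (hw : Wave23 γ V U₁ b U₆) :
    (∃ s < 0, IsShock1 γ U₁ U₄ s ∧ (∀ ξ ∈ Ioo 0 (-s), V' ξ = U₄.reflect) ∧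
      ∀ ξ > -s, V' ξ = U₁.reflect) ∧
    ∃ (X : State) (s r : ℝ), X.IsPhysical ∧ b < s ∧ s < r ∧ IsContact γ U₆ X s ∧
      IsShock3 γ X U₁ r ∧ (∀ ξ ∈ Ioo b s, V ξ = U₆) ∧ (∀ ξ ∈ Ioo s r, V ξ = X) ∧
      ∀ ξ > r, V ξ = U₁ := by
  have hsign := hw.sign hγ h₆ h₁
  have hl' : ∃ s < 0, IsShock1 γ U₁ U₄ s ∧ (∀ ξ ∈ Ioo 0 (-s), V' ξ = U₄.reflect) ∧
      ∀ ξ > -s, V' ξ = U₁.reflect := by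
    rcases hl with ⟨h, -⟩ | ⟨s, h1, h2, h3, h4⟩ | ⟨-, h2, h3⟩
    · have := reflect_injective h
      subst this
      rcases hsign with ⟨h1, h2⟩ | ⟨h1, h2⟩ | ⟨h1, h2⟩ <;> linarith
    · exact ⟨-s, by linarith, by simpa using h2.reflect, by simpa using h3, by simpa using h4⟩
    · simp only [vel_reflect, pres_reflect] at h2 h3
      rcases hsign with ⟨h4, h5⟩ | ⟨h4, h5⟩ | ⟨h4, h5⟩ <;> linarith
  refine ⟨hl', ?_⟩
  obtain ⟨s, hs0, hS, -⟩ := hl'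
  obtain ⟨j, hj, -, hj₄, s1, s2, s3, -⟩ := hS.relations hγ h₁ h₄
  obtain ⟨e1, e2, -⟩ := hH.relations hγ
  -- The 1-shock moves to the left, so the mass flux through it exceeds the flux through `x = 0`.
  have hm : U₄.rho * U₄.vel < j := by
    have := mul_neg_of_pos_of_neg h₄.1 hs0
    linarith
  -- A nontrivial fan starts from a sonic state, where `ρ a` is the mass flux through `x = 0`.
  have hm₅ : U₅.pres - U₆.pres ≤ U₄.rho * U₄.vel * (U₆.vel - U₅.vel) := by
    rcases hs with h | rfl
    · rwa [e1, show U₅.vel = U₅.sound γ by simp only [char1] at h; linarith] at *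
    · simp
  refine hw.contact_shock hγ h₆ h₁ (fun hp => ?_) fun hp => ?_
  · by_contra hn
    -- The left side is the pressure rise in the 1-shock; the right side bounds the pressure drop
    -- from `U₄` to `U₆`.
    have k1 : j * (U₁.vel - U₄.vel) ≤ U₄.rho * U₄.vel * (U₆.vel - U₄.vel) := by linarith
    have k2 : U₄.rho * U₄.vel * (U₆.vel - U₄.vel) < j * (U₆.vel - U₄.vel) :=
      mul_lt_mul_of_pos_right hm (by linarith)
    have k3 := lt_of_mul_lt_mul_left (k1.trans_lt k2) hj.le
    linarith
  · exact (hH.belowHugoniot_of_shock hγ hQ h₁ h₄ h₅ hS hu hp₅ (hp.trans_le hp₆)).of_rarefaction1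
      hγ h₁ h₅ h₆ hp₆ hr

theorem IsExactSolution.tail_right {γ Q : ℝ} (hγ : 1 < γ) {U₁ : State}
    (h₁ : U₁.IsPhysical) {U : ℝ → ℝ → State} {U₄ U₅ : State}
    (hU : IsExactSolution γ Q U₁ U U₄ U₅) : Tail γ (fun ξ => U ξ 1) U₁ 0 U₅ := by
  obtain ⟨D, hD⟩ := hU.right.isProfile hγ h₁ (hU.initial 1 one_ne_zero)
  exact hD.tail hγ le_rfl hU.physical_right (hU.limit_right 1 one_pos)

theorem IsExactSolution.tail_left {γ Q : ℝ} (hγ : 1 < γ) {U₁ : State}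
    (h₁ : U₁.IsPhysical) {U : ℝ → ℝ → State} {U₄ U₅ : State}
    (hU : IsExactSolution γ Q U₁ U U₄ U₅) :
    Tail γ (fun ξ => (U (-ξ) 1).reflect) U₁.reflect 0 U₄.reflect := by
  obtain ⟨D, hD⟩ := hU.left.isProfile_reflect hγ h₁ (hU.initial (-1) (by norm_num))
  refine hD.tail hγ le_rfl hU.physical_left ((continuous_reflect.tendsto U₄).comp
    ((hU.limit_left 1 one_pos).comp ?_))
  simpa using tendsto_neg_nhdsGT (a := (0 : ℝ))

/-- The flow through the heating region is directed as the initial flow. -/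
theorem IsExactSolution.vel_left_pos {γ Q : ℝ} (hγ : 1 < γ) (hQ : 0 < Q) {U₁ : State}
    (h₁ : U₁.IsPhysical) (hu₁ : 0 < U₁.vel) {U : ℝ → ℝ → State} {U₄ U₅ : State}
    (hU : IsExactSolution γ Q U₁ U U₄ U₅) : 0 < U₄.vel := by
  have h₄ := hU.physical_left
  have h₅ := hU.physical_right
  have k₄ : U₄.reflect.IsPhysical := isPhysical_reflect.2 h₄
  have k₅ : U₅.reflect.IsPhysical := isPhysical_reflect.2 h₅
  have k₁ : U₁.reflect.IsPhysical := isPhysical_reflect.2 h₁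
  by_contra hn
  have hn₅ : U₅.vel < 0 :=
    lt_of_le_of_ne (not_lt.1 (mt (hU.heating.vel_pos_iff hγ h₄ h₅).2 hn)) hU.heating.vel_right
  have hn₄ : 0 < U₄.reflect.vel := by
    simpa using lt_of_le_of_ne (not_lt.1 hn) hU.heating.vel_left
  have hH := hU.heating.reflect hγ h₄ h₅
  have hR := (hU.tail_right hγ h₁).wave3 hγ hn₅.le
  rcases hH.subsonic_or_supersonic hγ hQ k₅ k₄ (by simpa using hn₅) with
    ⟨-, hM, -, hp, hu⟩ | ⟨hM, -⟩
  · have hc : U₄.reflect.char1 γ ≤ 0 :=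
      not_lt.1 (mt (one_lt_mach_iff_char1 hγ k₄ hn₄).2 hM.not_gt)
    obtain ⟨X, hX, -, k1, k2, -, k3⟩ :=
      (hU.tail_left hγ h₁).wave123 hγ |>.of_char1_nonpos hγ k₄ hc
    obtain ⟨b, hb⟩ : ∃ b, Wave23 γ (fun ξ => (U (-ξ) 1).reflect) U₁.reflect b X := by
      rcases k3 with ⟨-, h⟩ | ⟨-, -, h⟩ <;> exact ⟨_, h⟩
    have s1 := hb.sign hγ hX k₁
    have s2 := hR.sign hγ h₅ h₁
    simp only [vel_reflect, pres_reflect] at *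
    -- Reversed flow makes `X` faster than `U₁.reflect`, so its pressure exceeds that of `U₁`;
    -- likewise `U₅` is slower than `U₁`, so its pressure is smaller. But from `U₅` to `X` the
    -- pressure falls.
    rcases s1 with ⟨h1, h2⟩ | ⟨h1, h2⟩ | ⟨h1, h2⟩ <;>
    rcases s2 with ⟨h3, h4⟩ | ⟨h3, h4⟩ | ⟨h3, h4⟩ <;> linarith
  · have hc := (one_lt_mach_iff_char1 hγ k₅ (by simpa using hn₅)).1 hM
    rw [char1_reflect] at hc
    -- The inflow from the right is supersonic, so no 3-wave can enter `x > 0`.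
    rcases hR with ⟨h, -⟩ | ⟨s, h1, h2, -⟩ | ⟨h1, -⟩
    · rw [h] at hn₅
      exact hn₅.not_gt hu₁
    · linarith [h2.2.2.1]
    · linarith

theorem SolvesEulerOn.eq_of_profile {γ : ℝ} {Ω : Set ℝ} {U : ℝ → ℝ → State}
    (h : SolvesEulerOn γ Ω U) {x t : ℝ} (hx : x ∈ Ω) (ht : 0 < t) {W : State}
    (hW : U (x / t) 1 = W) : U x t = W :=
  (h.eq_profile hx ht).trans hW

theorem SolvesEulerOn.constOn {γ : ℝ} {U : ℝ → ℝ → State} (h : SolvesEulerOn γ (Ioi 0) U)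
    {b c : ℝ} (hb : 0 ≤ b) {W : State} (hW : ∀ ξ ∈ Ioo b c, U ξ 1 = W) : ConstOn U b c W := by
  intro t ht x h1 h2
  have hx : 0 < x := (by positivity : 0 ≤ b * t).trans_lt h1
  exact h.eq_of_profile hx ht (hW _ ⟨(lt_div_iff₀ ht).2 h1, (div_lt_iff₀ ht).2 h2⟩)

theorem SolvesEulerOn.eq_of_gt {γ : ℝ} {U : ℝ → ℝ → State} (h : SolvesEulerOn γ (Ioi 0) U)
    {b : ℝ} (hb : 0 ≤ b) {W : State} (hW : ∀ ξ > b, U ξ 1 = W) :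
    ∀ t > 0, ∀ x > b * t, U x t = W := by
  intro t ht x h1
  have hx : 0 < x := (by positivity : 0 ≤ b * t).trans_lt h1
  exact h.eq_of_profile hx ht (hW _ ((lt_div_iff₀ ht).2 h1))

theorem SolvesEulerOn.constOn_of_reflect {γ : ℝ} {U : ℝ → ℝ → State}
    (h : SolvesEulerOn γ (Iio 0) U) {s : ℝ} {W : State}
    (hW : ∀ ξ ∈ Ioo 0 (-s), (U (-ξ) 1).reflect = W.reflect) : ConstOn U s 0 W := by
  intro t ht x h1 h2
  rw [zero_mul] at h2
  refine h.eq_of_profile h2 ht (reflect_injective ?_)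
  have := hW (-(x / t)) ⟨neg_pos.2 (div_neg_of_neg_of_pos h2 ht),
    neg_lt_neg ((lt_div_iff₀ ht).2 h1)⟩
  rwa [neg_neg] at this

theorem SolvesEulerOn.eq_of_lt_of_reflect {γ : ℝ} {U : ℝ → ℝ → State}
    (h : SolvesEulerOn γ (Iio 0) U) {s : ℝ} (hs : s ≤ 0) {W : State}
    (hW : ∀ ξ > -s, (U (-ξ) 1).reflect = W.reflect) : ∀ t > 0, ∀ x < s * t, U x t = W := by
  intro t ht x h1
  have hx : x < 0 := h1.trans_le (mul_nonpos_of_nonpos_of_nonneg hs ht.le)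
  refine h.eq_of_profile hx ht (reflect_injective ?_)
  have := hW (-(x / t)) (neg_lt_neg ((div_lt_iff₀ ht).2 h1))
  rwa [neg_neg] at this

theorem SolvesEulerOn.fanOn {γ : ℝ} {U : ℝ → ℝ → State} (h : SolvesEulerOn γ (Ioi 0) U)
    {W X : State} (hc : 0 ≤ W.char1 γ)
    (hfan : ∀ ξ > 0, W.char1 γ ≤ ξ → ξ ≤ X.char1 γ →
      (U ξ 1).IsPhysical ∧ SameInvariants1 γ W (U ξ 1) ∧ (U ξ 1).char1 γ = ξ) :
    FanOn γ U W X := by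
  intro t ht x hx h1 h2
  have hx0 : 0 < x := lt_of_le_of_ne ((mul_nonneg hc ht.le).trans h1) hx.symm
  rw [h.eq_profile hx0 ht]
  exact hfan _ (div_pos hx0 ht) ((le_div_iff₀ ht).2 h1) ((div_le_iff₀ ht).2 h2)

theorem mainTheorem1 (γ Q : ℝ) (hγ : 1 < γ) (hγ3 : γ ≤ 3) (hQ : 0 < Q)
    (U₁ : State) (hU₁ : U₁.IsPhysical) (hu₁ : 0 < U₁.vel)
    (U : ℝ → ℝ → State) (U₄ U₅ : State) (hU : IsExactSolution γ Q U₁ U U₄ U₅) :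
    (U₄.mach γ < U₅.mach γ ∧ U₅.mach γ < 1 ∧ IsType1 γ Q U₁ U U₄ U₅) ∨
    (U₄.mach γ < U₅.mach γ ∧ U₅.mach γ = 1 ∧ IsType2 γ Q U₁ U U₄ U₅) ∨
    (U₅.mach γ < U₄.mach γ ∧ 1 ≤ U₅.mach γ ∧ IsType3 γ Q U₁ U U₄ U₅) := by
  have hu₄ := hU.vel_left_pos hγ hQ hU₁ hu₁
  have h₄ := hU.physical_left
  have h₅ := hU.physical_right
  have hH := hU.heating
  have hu₅ := (hH.vel_pos_iff hγ h₄ h₅).1 hu₄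
  -- In the mirror image the gas leaves the half plane through `0`, so only a mirrored 1-wave can
  -- occur.
  have hL := (hU.tail_left hγ hU₁).wave3 hγ (by simpa using hu₄.le)
  have hR := (hU.tail_right hγ hU₁).wave123 hγ
  rcases hH.subsonic_or_supersonic hγ hQ h₄ h₅ hu₄ with
    ⟨-, hM₅, hM, hp, hu⟩ | ⟨hM₄, hM₅, hM, hp, hu⟩
  · have hc : U₅.char1 γ ≤ 0 := not_lt.1 (mt (one_lt_mach_iff_char1 hγ h₅ hu₅).2 hM₅.not_gt)
    obtain ⟨U₆, h₆, hr, hp₆, hu₆, hpu, hW⟩ := hR.of_char1_nonpos hγ h₅ hc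
    have core {b : ℝ} := exists_shock1_of_subsonic (V := fun ξ => U ξ 1) (b := b) hγ hQ hU₁ h₄ h₅ h₆ hu₄ hH hp hu hr
      hp₆ hu₆ hpu (hW.symm.imp (fun h => h.1) fun h => h.1) hL
    rcases hM₅.lt_or_eq with hM₅ | hM₅
    · have hc := (mach_lt_one_iff_char1 hγ h₅ hu₅).1 hM₅
      rcases hW with ⟨rfl, hW⟩ | ⟨h0, -⟩
      · obtain ⟨⟨sL, hsL, hS, hc₄, hc₁⟩, X, s, r, hX, hs, hsr, hC, hS₃, k1, k2, k3⟩ := core hW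
        exact Or.inl ⟨hM, hM₅, X, sL, s, r, hX, hsL, hs, hsr, hS, hH, hC, hS₃,
          hU.left.eq_of_lt_of_reflect hsL.le hc₁, hU.left.constOn_of_reflect hc₄,
          hU.right.constOn le_rfl k1, hU.right.constOn hs.le k2,
          hU.right.eq_of_gt (hs.trans hsr).le k3⟩
      · exact absurd h0 hc.ne
    · have hc : U₅.char1 γ = 0 :=
        le_antisymm hc (not_lt.1 (mt (mach_lt_one_iff_char1 hγ h₅ hu₅).2 hM₅.not_lt))
      obtain ⟨hfan, hW⟩ : (∀ ξ > 0, U₅.char1 γ ≤ ξ → ξ ≤ U₆.char1 γ →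
          (U ξ 1).IsPhysical ∧ SameInvariants1 γ U₅ (U ξ 1) ∧ (U ξ 1).char1 γ = ξ) ∧
          Wave23 γ (fun ξ => U ξ 1) U₁ (U₆.char1 γ) U₆ := by
        rcases hW with ⟨rfl, hW⟩ | ⟨-, hfan, hW⟩
        -- For the degenerate rarefaction the fan is the single ray `ξ = 0`, which `ξ > 0` excludes.
        · exact ⟨fun ξ h1 _ h2 => absurd (h2.trans hc.le) h1.not_ge, by rwa [hc]⟩
        · exact ⟨hfan, hW⟩
      obtain ⟨⟨sL, hsL, hS, hc₄, hc₁⟩, X, s, r, hX, hs, hsr, hC, hS₃, k1, k2, k3⟩ := core hW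
      have hc₆ : 0 ≤ U₆.char1 γ := hc.ge.trans hr.2
      exact Or.inr (Or.inl ⟨hM, hM₅, U₆, X, sL, s, r, h₆, hX, hsL, hc, hs, hc₆.trans_lt hs, hsr,
        hS, hH, hr, hC, hS₃, hU.left.eq_of_lt_of_reflect hsL.le hc₁,
        hU.left.constOn_of_reflect hc₄, hU.right.fanOn hc.ge hfan, hU.right.constOn hc₆ k1,
        hU.right.constOn (hc₆.trans hs.le) k2, hU.right.eq_of_gt (hc₆.trans (hs.trans hsr).le) k3⟩)
  · have hc₄ := (one_lt_mach_iff_char1 hγ h₄ hu₄).1 hM₄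
    have hc₅ : 0 ≤ U₅.char1 γ := not_lt.1 (mt (mach_lt_one_iff_char1 hγ h₅ hu₅).2 hM₅.not_gt)
    -- Supersonic inflow admits no wave in `x < 0`: a 1-wave ending at `U₄` would need a positive
    -- speed.
    rcases hL with ⟨h, hV⟩ | ⟨s, h1, h2, -⟩ | ⟨h1, -⟩
    · have h41 := reflect_injective h
      subst h41
      obtain ⟨e1, e2, -⟩ := hH.relations hγ
      rcases hR with hW | ⟨X, s, -, hX, hS, hW⟩ | ⟨U₆, h₆, -, hc₆, hI, k0, hfan, hW⟩
      -- Heating has raised the pressure and lowered the velocity, and a 1-shock would do so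
      -- further; a contact and a 3-wave cannot undo both. Only the 1-rarefaction remains.
      · rcases hW.sign hγ h₅ h₄ with ⟨h1, h2⟩ | ⟨h1, h2⟩ | ⟨h1, h2⟩ <;> linarith
      · obtain ⟨-, -, -, -, -, h3, h4, -⟩ := hS.relations hγ h₅ hX
        rcases hW.sign hγ hX h₄ with ⟨h1, h2⟩ | ⟨h1, h2⟩ | ⟨h1, h2⟩ <;> linarith
      · have hr : IsRarefaction1 γ U₅ U₆ := ⟨hI, hc₆.le⟩
        obtain ⟨r1, r2, r3⟩ := hr.relations hγ h₅ h₆ hc₆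
        have hm : U₅.rho * U₅.sound γ * (U₆.vel - U₅.vel)
            ≤ U₄.rho * U₄.vel * (U₆.vel - U₅.vel) := by
          rw [e1]
          simp only [char1] at hc₅
          exact mul_le_mul_of_nonneg_right
            (mul_le_mul_of_nonneg_left (by linarith) h₅.1.le) (by linarith)
        obtain ⟨X, s, r, hX, hs, hsr, hC, hS₃, k1, k2, k3⟩ := hW.contact_shock hγ h₆ h₄
          (fun hp₆ => by
            -- The pressure rise through heating is at most the drop in the fan, because `p₆ ≤ p₁`;
            -- that drop is bounded with the mass flux, which is at least `ρ₅ a₅`.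
            have h5 : U₄.rho * U₄.vel * (U₄.vel - U₅.vel)
                < U₄.rho * U₄.vel * (U₆.vel - U₅.vel) := by linarith
            linarith [lt_of_mul_lt_mul_left h5 (mul_pos h₄.1 hu₄).le])
          fun _ => (hH.belowHugoniot hγ hQ h₄ h₅ hu₄).of_rarefaction1 hγ h₄ h₅ h₆ r2.le hr
        have hc₆0 := hc₅.trans hc₆.le
        refine Or.inr (Or.inr ⟨hM, hM₅, rfl, U₆, X, s, r, h₆, hX, hc₅, hc₆, hs, hsr, hH, hr, hC,
          hS₃, fun t ht x hx => ?_, hU.right.constOn le_rfl k0, hU.right.fanOn hc₅ hfan,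
          hU.right.constOn hc₆0 k1, hU.right.constOn (hc₆0.trans hs.le) k2,
          hU.right.eq_of_gt (hc₆0.trans (hs.trans hsr).le) k3⟩)
        exact hU.left.eq_of_lt_of_reflect le_rfl (by simpa using hV) t ht x (by simpa using hx)
    · have := h2.2.2.1
      rw [char3_reflect] at this
      linarith
    · rw [char3_reflect] at h1
      linarith

end
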